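/- For $w\in\mathbb{C}$ let $e_w=\frac{dz}{z-w}$, let $\chi(\tau)=\frac{\tau+\tau^{-1}}{2}$, and for $x,y\in\{\pm1\}$ put $$h_{x,y}=\begin{cases}2e_x-e_0 & x=y,\\ e_0 & x\neq y.\end{cases}$$ For a path $\gamma:[0,1]\to\mathbb{C}$ and one-forms $\omega_1,\dots,\omega_n$, holomorphic on a neighbourhood of $\gamma((0,1))$, let $$I_\gamma(\gamma(0);\omega_1\cdots\omega_n;\gamma(1))=\int_{0<t_1<\cdots<t_n<1}\omega_1(\gamma(t_1))\cdots\omega_n(\gamma(t_n)),$$ understood as the limit of the integrals over $a<t_1<\cdots<t_n<b$ as $a\to0^+$ and $b\to1^-$ independently (it is $1$ for $n=0$). Let $I_{\mathrm{dch}}(1;\dots;-1)$ denote the iterated integral along the straight path from $1$ to $-1$. **Theorem.** Let $n\ge0$ and $x_0,\dots,x_{n+1}\in\{\pm1\}$ with $1=x_0\neq x_1$ and $x_n\neq x_{n+1}=-1$. Let $\gamma:[0,1]\to\mathbb{C}$ be a piecewise continuously differentiable path from $1$ to $-1$ with $\gamma((0,1))\subset\mathbb{C}\setminus\{0,1,-1\}$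 that makes a counterclockwise half-turn around $0$, i.e. that is homotopic to the half-circle $t\mapsto e^{\pi i t}$ with fixed endpoints, through paths that lie in $\mathbb{C}\setminus\{0,1,-1\}$ for $0<t<1$. Assume that $\gamma$ does not circulate infinitely often around its endpoints, i.e. that continuous branches of $\arg(\gamma(t)-1)$ and of $\arg(\gamma(t)+1)$, $0<t<1$, are bounded. Then the following iterated integrals all converge, and $$I_{\mathrm{dch}}(1;e_{x_1}\cdots e_{x_n};-1)=I_{\chi\circ\gamma}(1;e_{x_1}\cdots e_{x_n};-1)=\frac{1}{\pi i}\,I_\gamma(1;h_{x_0,x_1}h_{x_1,x_2}\cdots h_{x_n,x_{n+1}};-1).$$ -/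

import Mathlib

open Set Filter Topology MeasureTheory

namespace IterInt

/-- The open ordered simplex `a < t₁ < ⋯ < tₙ < b`. -/
def simplex (n : ℕ) (a b : ℝ) : Set (Fin n → ℝ) :=
  {t | StrictMono t ∧ ∀ i, t i ∈ Ioo a b}

/-- The iterated integral `∫_{a<t₁<⋯<tₙ<b} ω₁(γ(t₁)) ⋯ ωₙ(γ(tₙ))` of the one-forms `ω i (z) dz`
along the part of `γ` between the times `a` and `b`. For `n = 0` it equals `1`. -/
noncomputable def truncated (γ : ℝ → ℂ) {n : ℕ} (ω : Fin n → ℂ → ℂ) (a b : ℝ) : ℂ :=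
  ∫ t in simplex n a b, ∏ i, ω i (γ (t i)) * deriv γ (t i)

/-- The iterated integral `I_γ(γ(0); ω₁ ⋯ ωₙ; γ(1)) = ∫_{0<t₁<⋯<tₙ<1} ω₁(γ(t₁)) ⋯ ωₙ(γ(tₙ))`
converges and has the value `L`. The forms may have poles at the two endpoints of `γ`, so this is an
improper integral: the limit of the integrals over `a < t₁ < ⋯ < tₙ < b` as `a → 0⁺` and `b → 1⁻`
independently. -/
def HasIteratedIntegral (γ : ℝ → ℂ) {n : ℕ} (ω : Fin n → ℂ → ℂ) (L : ℂ) : Prop :=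
  Tendsto (fun p : ℝ × ℝ => truncated γ ω p.1 p.2) (𝓝[>] (0 : ℝ) ×ˢ 𝓝[<] (1 : ℝ)) (𝓝 L)

/-- `γ : [0,1] → ℂ` is continuous and piecewise continuously differentiable. -/
def PiecewiseC1 (γ : ℝ → ℂ) : Prop :=
  ∃ (m : ℕ) (c : ℕ → ℝ), c 0 = 0 ∧ c m = 1 ∧ (∀ i < m, c i < c (i + 1)) ∧
    ∀ i < m, ContDiffOn ℝ 1 γ (Icc (c i) (c (i + 1)))

/-- A continuous branch of the argument of `γ(t) - p`, `0 < t < 1`, is bounded: for an endpoint `p`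
of `γ`, this says that `γ` does not circulate around `p` infinitely many times. -/
def BoundedArg (γ : ℝ → ℂ) (p : ℂ) : Prop :=
  ∃ θ : ℝ → ℝ, ContinuousOn θ (Ioo 0 1) ∧ (∃ C, ∀ t ∈ Ioo (0 : ℝ) 1, |θ t| ≤ C) ∧
    ∀ t ∈ Ioo (0 : ℝ) 1, γ t - p = ‖γ t - p‖ * Complex.exp (θ t * Complex.I)

/-- `γ₀` and `γ₁` are homotopic with fixed endpoints, through paths that run in `U` at all times
`0 < t < 1` (the endpoints need not belong to `U`). -/
def HomotopicIn (U : Set ℂ) (γ₀ γ₁ : ℝ → ℂ) : Prop :=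
  ∃ H : ℝ × ℝ → ℂ, ContinuousOn H (Icc 0 1 ×ˢ Icc 0 1) ∧
    (∀ t ∈ Icc (0 : ℝ) 1, H (0, t) = γ₀ t ∧ H (1, t) = γ₁ t) ∧
    ∀ s ∈ Icc (0 : ℝ) 1, H (s, 0) = γ₀ 0 ∧ H (s, 1) = γ₀ 1 ∧ ∀ t ∈ Ioo (0 : ℝ) 1, H (s, t) ∈ U

/-- The upper unit half-circle from `1` to `-1`, run through counterclockwise. -/
noncomputable def halfCircle (t : ℝ) : ℂ := Complex.exp (Real.pi * t * Complex.I)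

/-- The straight path from `1` to `-1`. -/
def dch (t : ℝ) : ℂ := 1 - 2 * t

/-- A (piecewise smooth, well-behaved) path from `1` to `-1` in `ℂ ∖ {0, 1, -1}` that makes a
counterclockwise half-turn around `0`. -/
structure IsHalfTurn (γ : ℝ → ℂ) : Prop where
  source : γ 0 = 1
  target : γ 1 = -1
  mem : ∀ t ∈ Ioo (0 : ℝ) 1, γ t ∈ ({0, 1, -1} : Set ℂ)ᶜ
  piecewise : PiecewiseC1 γ
  arg_source : BoundedArg γ 1
  arg_target : BoundedArg γ (-1)
  halfTurn : HomotopicIn ({0, 1, -1} : Set ℂ)ᶜ halfCircle γ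

/-- The map `τ ↦ (τ + τ⁻¹) / 2`. -/
noncomputable def chi (τ : ℂ) : ℂ := (τ + τ⁻¹) / 2

/-- The one-form `e_w = dz / (z - w)`. -/
noncomputable def e (w : ℂ) (z : ℂ) : ℂ := 1 / (z - w)

/-- The one-forms `h_{x,x} = 2 e_x - e_0` and `h_{x,-x} = e_0` for `x = ±1`. -/
noncomputable def h (x y : ℤˣ) (z : ℂ) : ℂ :=
  if x = y then 2 * e ((x : ℤ) : ℂ) z - e 0 z else e 0 z

end IterInt

/-! On the half-circle the theorem becomes an identity between integrals of positive functions, and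
homotopy invariance carries it to every half-turn.

Reduction. Since $x_1=-1$ and $x_n=1$, the first letter of each word is regular at $1$ and the last
is regular at $-1$. So horizontal sections that are trivial at an endpoint extend holomorphically
over it, while the iterated integrals themselves grow at most like powers of the logarithm near it.
Bounded argument makes $\gamma-p$ beat such powers, so the improper integrals converge and their
values are pairings of a continued section at $1$ with a dual section at $-1$
(`IsHalfTurn.tendsto_iter`). Analytic continuation along a grid shows that this pairing is the same
for homotopic paths (`homotopy_pairing`, `exists_tendsto_iter`). As $\chi^*e_x=h_{x,x}$ (`e_chi`),
the integral along $\chi\circ\gamma$ is also an integral along $\gamma$ and falls under the same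
argument.

Half-circle. Put $\chi=1-2v$, $0<v<1$, and let $q_1=v$, $q_{-1}=1-v$. The form $h_{x,y}$ becomes a
constant times $(q_xq_y)^{-1/2}dv$, and $e_x$ becomes $\pm q_x^{-1}dv$ (`h_halfCircle`, `e_dch`).
The constants multiply up to a single extra factor $i$ (`prod_phase`). What remains is
$$\int\prod_{i=0}^{n}(q_{x_i}q_{x_{i+1}})^{-1/2}=\pi\int\prod_{i=1}^{n}q_{x_i}^{-1}$$ over the
simplices of dimension $n+1$ and $n$.

Abel transform. This follows from a statement with a variable endpoint $u$ (`abel_liter`):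
integrating the partial integral of the left word, times $q_{x_j}^{-1/2}$, against $(u-v)^{-1/2}$
gives $\pi$ times the partial integral of the right word. The induction starts with the arcsine
integral. Its step is the kernel identity `lintegral_kernel`, due to a Möbius involution that
exchanges the two limits of integration. At $u=1$ the kernel is $q_{-1}^{-1/2}$, which supplies the
last letter.

Convergence along the half-circle implies absolute convergence, by positivity. Tonelli's theorem
transfers it to the right word, which yields convergence along the straight path. -/

namespace IterInt

/-! ### Iterated integrals as repeated one-dimensional integrals -/

/-- The iterated integral of the first `m` letters of the word `φ` over `[a, b]`, computed by
repeated integration. -/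
noncomputable def iter (φ : ℕ → ℝ → ℂ) : ℕ → ℝ → ℝ → ℂ
  | 0, _, _ => 1
  | m + 1, a, b => ∫ t in a..b, iter φ m a t * φ m t

/-- The letters are integrable on compact subintervals of `(0, 1)`. -/
def LocInt (φ : ℕ → ℝ → ℂ) : Prop :=
  ∀ k, ∀ a ∈ Ioo (0 : ℝ) 1, ∀ b ∈ Ioo (0 : ℝ) 1, IntervalIntegrable (φ k) volume a b

/-- The word `φ` without its first `k` letters. -/
def shift (k : ℕ) (φ : ℕ → ℝ → ℂ) : ℕ → ℝ → ℂ := fun i => φ (i + k)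

/-- `R` is a horizontal section of the connection given by `φ` over `[[a, b]]`. -/
def IsRow (φ R : ℕ → ℝ → ℂ) (a b : ℝ) : Prop :=
  (∀ t ∈ uIcc a b, R 0 t = R 0 a) ∧
    ∀ k, ∀ t ∈ uIcc a b, R (k + 1) t = R (k + 1) a + ∫ s in a..t, R k s * φ k s

theorem LocInt.shift {φ : ℕ → ℝ → ℂ} (hφ : LocInt φ) (k : ℕ) : LocInt (shift k φ) :=
  fun i => hφ (i + k)

theorem uIcc_subset_Ioo {a b : ℝ} (ha : a ∈ Ioo (0 : ℝ) 1) (hb : b ∈ Ioo (0 : ℝ) 1) :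
    uIcc a b ⊆ Ioo (0 : ℝ) 1 := ordConnected_Ioo.uIcc_subset ha hb

theorem continuousOn_iter {φ : ℕ → ℝ → ℂ} {a b : ℝ}
    (hφ : ∀ k, IntervalIntegrable (φ k) volume a b) (m : ℕ) :
    ContinuousOn (iter φ m a) (uIcc a b) := by
  induction m with
  | zero => exact continuousOn_const
  | succ m ih =>
    exact intervalIntegral.continuousOn_primitive_interval' ((hφ m).continuousOn_mul ih)
      left_mem_uIcc

theorem intervalIntegrable_iter_mul {φ : ℕ → ℝ → ℂ} {a b : ℝ}
    (hφ : ∀ k, IntervalIntegrable (φ k) volume a b) (m : ℕ) :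
    IntervalIntegrable (fun t => iter φ m a t * φ m t) volume a b :=
  (hφ m).continuousOn_mul (continuousOn_iter hφ m)

theorem LocInt.continuousOn_iter {φ : ℕ → ℝ → ℂ} (hφ : LocInt φ) {a : ℝ}
    (ha : a ∈ Ioo (0 : ℝ) 1) (m : ℕ) : ContinuousOn (iter φ m a) (Ioo 0 1) := by
  intro t ht
  obtain ⟨u, hu1, hu2⟩ := exists_between ht.1
  obtain ⟨w, hw1, hw2⟩ := exists_between ht.2
  have hu : u ∈ Ioo (0 : ℝ) 1 := ⟨hu1, hu2.trans ht.2⟩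
  have hw : w ∈ Ioo (0 : ℝ) 1 := ⟨ht.1.trans hw1, hw2⟩
  have hmin : min u a ∈ Ioo (0 : ℝ) 1 := ⟨lt_min hu.1 ha.1, min_lt_of_right_lt ha.2⟩
  have hmax : max w a ∈ Ioo (0 : ℝ) 1 := ⟨lt_max_of_lt_right ha.1, max_lt hw.2 ha.2⟩
  have key : ContinuousOn (iter φ m a) (uIcc (min u a) (max w a)) := by
    cases m with
    | zero => exact continuousOn_const
    | succ m =>
      refine intervalIntegral.continuousOn_primitive_interval' ?_
        (by rw [uIcc_of_le ((min_le_right _ _).trans (le_max_right _ _))]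
            exact ⟨min_le_right _ _, le_max_right _ _⟩)
      have h1 := intervalIntegrable_iter_mul (fun k => hφ k a ha _ hmin) m
      have h2 := intervalIntegrable_iter_mul (fun k => hφ k a ha _ hmax) m
      exact h1.symm.trans h2
  have hnhds : uIcc (min u a) (max w a) ∈ 𝓝 t := by
    rw [uIcc_of_le ((min_le_right _ _).trans (le_max_right _ _))]
    exact Icc_mem_nhds (min_lt_of_left_lt hu2) (lt_max_of_lt_left hw1)
  exact (key.continuousAt hnhds).continuousWithinAt

/-- Parallel transport is the matrix of iterated integrals of subwords. This is the only uniqueness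
statement for rows that is needed: path composition, asymptotics at the punctures and continuation
all apply it to suitable rows. -/
theorem IsRow.eq_sum {φ R : ℕ → ℝ → ℂ} {a b : ℝ} (hR : IsRow φ R a b)
    (hφ : ∀ k, IntervalIntegrable (φ k) volume a b) (m : ℕ) :
    ∀ t ∈ uIcc a b,
      R m t = ∑ k ∈ Finset.range (m + 1), R k a * iter (shift k φ) (m - k) a t := by
  induction m with
  | zero => intro t ht; simp [iter, hR.1 t ht]
  | succ m ih =>
    intro t ht
    have hsub : uIcc a t ⊆ uIcc a b := uIcc_subset_uIcc_left ht
    have hφt : ∀ k, IntervalIntegrable (φ k) volume a t := fun k => (hφ k).mono_set hsub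
    rw [hR.2 m t ht, Finset.sum_range_succ, add_comm]
    congr 1
    · have h1 : ∫ s in a..t, R m s * φ m s = ∫ s in a..t, ∑ k ∈ Finset.range (m + 1),
          R k a * (iter (shift k φ) (m - k) a s * shift k φ (m - k) s) := by
        refine intervalIntegral.integral_congr fun s hs => ?_
        simp only [ih s (hsub hs), Finset.sum_mul]
        refine Finset.sum_congr rfl fun k hk => ?_
        have : m - k + k = m := Nat.sub_add_cancel (Finset.mem_range_succ_iff.1 hk)
        simp [shift, this, mul_assoc]
      rw [h1, intervalIntegral.integral_finsetSum]
      · refine Finset.sum_congr rfl fun k hk => ?_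
        have : m + 1 - k = (m - k) + 1 := Nat.succ_sub (Finset.mem_range_succ_iff.1 hk)
        rw [intervalIntegral.integral_const_mul, this, iter]
      · intro k _
        exact (intervalIntegrable_iter_mul (φ := shift k φ) (fun i => hφt (i + k)) _).const_mul _
    · simp [iter]

theorem isRow_iter {φ : ℕ → ℝ → ℂ} (hφ : LocInt φ) {a b c : ℝ} (ha : a ∈ Ioo (0 : ℝ) 1)
    (hb : b ∈ Ioo (0 : ℝ) 1) (hc : c ∈ Ioo (0 : ℝ) 1) :
    IsRow φ (fun m => iter φ m a) b c := by
  refine ⟨fun t _ => rfl, fun k t ht => ?_⟩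
  have ht' := uIcc_subset_Ioo hb hc ht
  have h1 := intervalIntegrable_iter_mul (fun k => hφ k a ha _ hb) k
  have h2 := intervalIntegrable_iter_mul (fun k => hφ k a ha _ ht') k
  exact (intervalIntegral.integral_add_adjacent_intervals h1 (h1.symm.trans h2)).symm

/-- The path composition formula. -/
theorem iter_comp {φ : ℕ → ℝ → ℂ} (hφ : LocInt φ) {a b c : ℝ} (ha : a ∈ Ioo (0 : ℝ) 1)
    (hb : b ∈ Ioo (0 : ℝ) 1) (hc : c ∈ Ioo (0 : ℝ) 1) (m : ℕ) :
    iter φ m a c = ∑ k ∈ Finset.range (m + 1), iter φ k a b * iter (shift k φ) (m - k) b c :=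
  (isRow_iter hφ ha hb hc).eq_sum (fun k => hφ k b hb c hc) m c right_mem_uIcc

/-- Iterated integrals are invariant under a change of the parameter. -/
theorem iter_substitution {B : ℕ → ℝ → ℂ} (hB : ∀ k, ContinuousOn (B k) (Ioo 0 1))
    {v v' : ℝ → ℝ} (hv : ∀ t ∈ Ioo (0 : ℝ) 1, v t ∈ Ioo (0 : ℝ) 1)
    (hd : ∀ t ∈ Ioo (0 : ℝ) 1, HasDerivAt v (v' t) t) (hc : ContinuousOn v' (Ioo 0 1))
    (m : ℕ) {a b : ℝ} (ha : a ∈ Ioo (0 : ℝ) 1) (hb : b ∈ Ioo (0 : ℝ) 1) :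
    iter (fun k t => B k (v t) * (v' t : ℂ)) m a b = iter B m (v a) (v b) := by
  have hBl : LocInt B := fun k a ha b hb =>
    ((hB k).mono (uIcc_subset_Ioo ha hb)).intervalIntegrable
  induction m generalizing b with
  | zero => rfl
  | succ m ih =>
    have hsub := uIcc_subset_Ioo ha hb
    have hg : ContinuousOn (fun u => iter B m (v a) u * B m u) (Ioo 0 1) :=
      (hBl.continuousOn_iter (hv a ha) m).mul (hB m)
    have h1 := intervalIntegral.integral_deriv_smul_comp'' (a := a) (b := b) (f := v) (f' := v')
      (g := fun u => iter B m (v a) u * B m u)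
      (fun t ht => (hd t (hsub ht)).continuousAt.continuousWithinAt)
      (fun t ht => (hd t (hsub (Ioo_subset_Icc_self ht))).hasDerivWithinAt)
      (hc.mono hsub) (hg.mono (by rintro _ ⟨t, ht, rfl⟩; exact hv t (hsub ht)))
    simp only [iter]
    rw [← h1]
    refine intervalIntegral.integral_congr fun t ht => ?_
    simp only [ih (hsub ht), Function.comp, Complex.real_smul]
    ring

/-! ### Integrals over simplices -/

theorem measurableSet_simplex (n : ℕ) (a b : ℝ) : MeasurableSet (simplex n a b) := by
  have : simplex n a b = (⋂ (i : Fin n) (j : Fin n) (_ : i < j), {t | t i < t j}) ∩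
      ⋂ i : Fin n, {t | t i ∈ Ioo a b} := by
    ext t
    simp [simplex, StrictMono]
  rw [this]
  refine MeasurableSet.inter (MeasurableSet.iInter fun i => MeasurableSet.iInter fun j =>
    MeasurableSet.iInter fun _ => measurableSet_lt (measurable_pi_apply i) (measurable_pi_apply j))
    (MeasurableSet.iInter fun i => measurableSet_Ioo.preimage (measurable_pi_apply i))

theorem simplex_mono {n : ℕ} {a b a' b' : ℝ} (ha : a' ≤ a) (hb : b ≤ b') :
    simplex n a b ⊆ simplex n a' b' :=
  fun _ ht => ⟨ht.1, fun i => Ioo_subset_Ioo ha hb (ht.2 i)⟩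

theorem integrableOn_simplex {𝕜 : Type*} [NormedCommRing 𝕜] {n : ℕ} {a b : ℝ}
    {f : Fin n → ℝ → 𝕜} (hf : ∀ i, IntegrableOn (f i) (Ioo a b)) :
    IntegrableOn (fun t : Fin n → ℝ => ∏ i, f i (t i)) (simplex n a b) := by
  have h := Integrable.fintype_prod (μ := fun _ : Fin n => volume.restrict (Ioo a b)) hf
  rw [← Measure.restrict_pi_pi] at h
  exact IntegrableOn.mono_set h fun t ht i _ => ht.2 i

theorem mem_simplex_succ {n : ℕ} {a b : ℝ} (t : Fin (n + 1) → ℝ) :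
    t ∈ simplex (n + 1) a b ↔ t (Fin.last n) ∈ Ioo a b ∧
      (fun i : Fin n => t i.castSucc) ∈ simplex n a (t (Fin.last n)) := by
  constructor
  · rintro ⟨h1, h2⟩
    exact ⟨h2 _, fun i j hij => h1 (Fin.castSucc_lt_castSucc_iff.2 hij),
      fun i => ⟨(h2 _).1, h1 (Fin.castSucc_lt_last i)⟩⟩
  · rintro ⟨h1, h2, h3⟩
    refine ⟨fun i j hij => ?_, fun i => ?_⟩
    · induction j using Fin.lastCases with
      | last =>
        induction i using Fin.lastCases with
        | last => exact absurd hij (lt_irrefl _)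
        | cast i => exact (h3 i).2
      | cast j =>
        induction i using Fin.lastCases with
        | last => exact absurd (hij.trans (Fin.castSucc_lt_last j)) (lt_irrefl _)
        | cast i => exact h2 (Fin.castSucc_lt_castSucc_iff.1 hij)
    · induction i using Fin.lastCases with
      | last => exact h1
      | cast i => exact ⟨(h3 i).1, (h3 i).2.trans h1.2⟩

/-- The simplex of dimension `n + 1`, fibred over its last coordinate. -/
def fibredSimplex (n : ℕ) (a b : ℝ) : Set (ℝ × (Fin n → ℝ)) :=
  {p | p.1 ∈ Ioo a b ∧ p.2 ∈ simplex n a p.1}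

theorem piFinSuccAbove_last {n : ℕ} (t : Fin (n + 1) → ℝ) :
    MeasurableEquiv.piFinSuccAbove (fun _ : Fin (n + 1) => ℝ) (Fin.last n) t =
      (t (Fin.last n), fun i : Fin n => t i.castSucc) := by
  ext i
  · rfl
  · simp [MeasurableEquiv.piFinSuccAbove, Fin.insertNthEquiv, Fin.init]

theorem preimage_fibredSimplex (n : ℕ) (a b : ℝ) :
    MeasurableEquiv.piFinSuccAbove (fun _ : Fin (n + 1) => ℝ) (Fin.last n) ⁻¹'
      fibredSimplex n a b = simplex (n + 1) a b := by
  ext t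
  rw [mem_simplex_succ, mem_preimage, piFinSuccAbove_last]
  rfl

theorem measurableSet_fibredSimplex (n : ℕ) (a b : ℝ) : MeasurableSet (fibredSimplex n a b) := by
  have h := measurableSet_simplex (n + 1) a b
  rw [← preimage_fibredSimplex] at h
  exact (MeasurableEquiv.measurableSet_preimage _).1 h

theorem indicator_fibredSimplex {E : Type*} [Zero E] {n : ℕ} {a b : ℝ}
    (F : ℝ × (Fin n → ℝ) → E) (s : ℝ) (t : Fin n → ℝ) :
    (fibredSimplex n a b).indicator F (s, t) =
      (Ioo a b).indicator (fun s => (simplex n a s).indicator (fun t => F (s, t)) t) s := by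
  have h : (s, t) ∈ fibredSimplex n a b ↔ s ∈ Ioo a b ∧ t ∈ simplex n a s := Iff.rfl
  by_cases h1 : s ∈ Ioo a b <;> by_cases h2 : t ∈ simplex n a s <;>
    simp only [indicator, h, h1, h2, and_self, and_true, and_false, if_true, if_false]

/-- Fubini over the last, largest variable. It links the definition over simplices with repeated
integration, where differential equations can be used. -/
theorem integral_simplex {φ : ℕ → ℝ → ℂ} {a b : ℝ} (hab : a ≤ b)
    (hφ : ∀ k, IntegrableOn (φ k) (Ioo a b)) (n : ℕ) :
    ∫ t in simplex n a b, ∏ i : Fin n, φ i (t i) = iter φ n a b := by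
  induction n generalizing b with
  | zero =>
    have : simplex 0 a b = univ := by
      ext t; simp [simplex, StrictMono]
    simp [this, iter, Measure.real, volume_pi]
  | succ n ih =>
    have hmp := volume_preserving_piFinSuccAbove (fun _ : Fin (n + 1) => ℝ) (Fin.last n)
    have hemb := (MeasurableEquiv.piFinSuccAbove (fun _ : Fin (n + 1) => ℝ)
      (Fin.last n)).measurableEmbedding
    let F : ℝ × (Fin n → ℝ) → ℂ := fun p => (∏ i : Fin n, φ i (p.2 i)) * φ n p.1
    have hF : ∀ t : Fin (n + 1) → ℝ, ∏ i : Fin (n + 1), φ i (t i) =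
        F (MeasurableEquiv.piFinSuccAbove (fun _ : Fin (n + 1) => ℝ) (Fin.last n) t) := by
      intro t
      rw [piFinSuccAbove_last, Fin.prod_univ_castSucc]
      rfl
    have hint : IntegrableOn F (fibredSimplex n a b) := by
      have h := integrableOn_simplex (n := n + 1) (f := fun i => φ i) (fun i => hφ i)
      rw [← preimage_fibredSimplex] at h
      simp only [hF] at h
      exact (hmp.integrableOn_comp_preimage hemb).1 h
    simp only [hF]
    rw [← preimage_fibredSimplex, hmp.setIntegral_preimage_emb hemb,
      ← integral_indicator (measurableSet_fibredSimplex n a b), Measure.volume_eq_prod,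
      integral_prod]
    · simp only [indicator_fibredSimplex]
      rw [iter, intervalIntegral.integral_of_le hab, integral_Ioc_eq_integral_Ioo,
        ← integral_indicator measurableSet_Ioo]
      refine integral_congr_ae (Eventually.of_forall fun s => ?_)
      by_cases hs : s ∈ Ioo a b
      · simp only [indicator_of_mem hs]
        rw [integral_indicator (measurableSet_simplex n a s)]
        simp only [F]
        rw [integral_mul_const, ih hs.1.le fun k => (hφ k).mono_set (Ioo_subset_Ioo_right hs.2.le)]
      · simp [indicator_of_notMem hs]
    · rw [← Measure.volume_eq_prod]
      exact (integrable_indicator_iff (measurableSet_fibredSimplex n a b)).2 hint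

/-- Repeated integration of nonnegative functions. -/
noncomputable def liter (F : ℕ → ℝ → ENNReal) : ℕ → ℝ → ℝ → ENNReal
  | 0, _, _ => 1
  | m + 1, a, b => ∫⁻ t in Ioo a b, liter F m a t * F m t

/-- Monotonicity in the upper limit gives measurability without any assumption on `F`. -/
theorem measurable_liter (F : ℕ → ℝ → ENNReal) (m : ℕ) (a : ℝ) : Measurable (liter F m a) := by
  cases m with
  | zero => exact measurable_const
  | succ m =>
    have : Monotone (liter F (m + 1) a) := fun s t hst =>
      lintegral_mono_set (Ioo_subset_Ioo_right hst)
    exact this.measurable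

theorem lintegral_simplex {F : ℕ → ℝ → ENNReal} (hF : ∀ k, Measurable (F k)) (n : ℕ) (a b : ℝ) :
    ∫⁻ t in simplex n a b, ∏ i : Fin n, F i (t i) = liter F n a b := by
  induction n generalizing b with
  | zero =>
    have : simplex 0 a b = univ := by
      ext t; simp [simplex, StrictMono]
    simp [this, liter, volume_pi]
  | succ n ih =>
    have hmp := volume_preserving_piFinSuccAbove (fun _ : Fin (n + 1) => ℝ) (Fin.last n)
    have hemb := (MeasurableEquiv.piFinSuccAbove (fun _ : Fin (n + 1) => ℝ)
      (Fin.last n)).measurableEmbedding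
    let G : ℝ × (Fin n → ℝ) → ENNReal := fun p => (∏ i : Fin n, F i (p.2 i)) * F n p.1
    have hm : ∀ i : Fin n, Measurable fun t : Fin n → ℝ => F i (t i) := fun i =>
      (hF i).comp (measurable_pi_apply i)
    have hG : ∀ t : Fin (n + 1) → ℝ, ∏ i : Fin (n + 1), F i (t i) =
        G (MeasurableEquiv.piFinSuccAbove (fun _ : Fin (n + 1) => ℝ) (Fin.last n) t) := by
      intro t
      rw [piFinSuccAbove_last, Fin.prod_univ_castSucc]
      rfl
    have hGm : Measurable G := (Finset.measurable_fun_prod _ fun i _ =>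
      (hm i).comp measurable_snd).mul ((hF n).comp measurable_fst)
    simp only [hG]
    rw [← preimage_fibredSimplex, hmp.setLIntegral_comp_preimage_emb hemb,
      ← lintegral_indicator (measurableSet_fibredSimplex n a b), Measure.volume_eq_prod,
      lintegral_prod _ (hGm.indicator (measurableSet_fibredSimplex n a b)).aemeasurable]
    simp only [indicator_fibredSimplex]
    rw [liter, ← lintegral_indicator measurableSet_Ioo]
    refine lintegral_congr fun s => ?_
    by_cases hs : s ∈ Ioo a b
    · simp only [indicator_of_mem hs]
      rw [lintegral_indicator (measurableSet_simplex n a s)]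
      simp only [G]
      rw [lintegral_mul_const _ (Finset.measurable_fun_prod _ fun i _ => hm i), ih]
    · simp [indicator_of_notMem hs]

/-- Reversal of the parameter. -/
theorem iter_reverse {φ : ℕ → ℝ → ℂ} {a b : ℝ} (hab : a ≤ b)
    (hφ : ∀ k, IntegrableOn (φ k) (Ioo a b)) {ψ : ℕ → ℝ → ℂ} {n : ℕ}
    (hψi : ∀ k, IntegrableOn (ψ k) (Ioo (1 - b) (1 - a)))
    (hψ : ∀ i < n, ∀ t, ψ i t = φ (n - 1 - i) (1 - t)) :
    iter φ n a b = iter ψ n (1 - b) (1 - a) := by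
  rw [← integral_simplex hab hφ, ← integral_simplex (sub_le_sub_left hab 1) hψi]
  have h1 : MeasurePreserving (fun (t : Fin n → ℝ) i => 1 - t i) volume volume :=
    volume_preserving_pi fun _ => Measure.measurePreserving_sub_left volume 1
  have h2 := volume_measurePreserving_piCongrLeft (fun _ : Fin n => ℝ) Fin.revPerm
  have e1 : MeasurableEmbedding (fun (t : Fin n → ℝ) i => 1 - t i) :=
    (MeasurableEquiv.piCongrRight
      fun _ : Fin n => MeasurableEquiv.subLeft (1 : ℝ)).measurableEmbedding
  have h3 := h1.comp h2
  have e3 := e1.comp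
    (MeasurableEquiv.piCongrLeft (fun _ : Fin n => ℝ) Fin.revPerm).measurableEmbedding
  -- The reflection reverses the order of the coordinates, so it must be composed with the reversal
  -- of indices to carry one simplex onto the other.
  have happ : ∀ (t : Fin n → ℝ) i, ((fun (t : Fin n → ℝ) i => 1 - t i) ∘
      (MeasurableEquiv.piCongrLeft (fun _ : Fin n => ℝ) Fin.revPerm)) t i = 1 - t i.rev := by
    intro t i
    have := MeasurableEquiv.piCongrLeft_apply_apply (β := fun _ : Fin n => ℝ) (e := Fin.revPerm)
      t i.rev
    simp at this
    simp [this]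
  rw [← h3.setIntegral_preimage_emb e3]
  have hset : ((fun (t : Fin n → ℝ) i => 1 - t i) ∘
      (MeasurableEquiv.piCongrLeft (fun _ : Fin n => ℝ) Fin.revPerm)) ⁻¹' simplex n a b =
      simplex n (1 - b) (1 - a) := by
    ext t
    simp only [mem_preimage, simplex, mem_ofPred_eq, StrictMono, happ, mem_Ioo]
    constructor
    · rintro ⟨g1, g2⟩
      refine ⟨fun i j hij => ?_, fun i => ?_⟩
      · have := g1 (Fin.rev_lt_rev.2 hij)
        simp only [Fin.rev_rev] at this
        linarith
      · have := g2 i.rev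
        simp only [Fin.rev_rev] at this
        constructor <;> linarith [this.1, this.2]
    · rintro ⟨g1, g2⟩
      refine ⟨fun i j hij => ?_, fun i => ?_⟩
      · have := g1 (Fin.rev_lt_rev.2 hij)
        linarith
      · have := g2 i.rev
        constructor <;> linarith [this.1, this.2]
  rw [hset]
  refine integral_congr_ae (Eventually.of_forall fun t => ?_)
  simp only [happ]
  rw [← Equiv.prod_comp Fin.revPerm]
  refine Finset.prod_congr rfl fun i _ => ?_
  rw [hψ i i.2]
  simp only [Fin.revPerm_apply, Fin.rev_rev, Fin.val_rev]
  congr 1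
  omega

/-! ### The integral transform with kernel `(u - v) ^ (-1/2)` -/

/-- The affine coordinate vanishing at the endpoint `0` for the sign `1` and at the endpoint `1` for
the sign `-1`. -/
noncomputable def q (x : ℤˣ) (v : ℝ) : ℝ := if x = 1 then v else 1 - v

/-- The density `q ^ (-1/2)`. -/
noncomputable def k (x : ℤˣ) (v : ℝ) : ENNReal := ENNReal.ofReal (√(q x v))⁻¹

/-- The Abel kernel. -/
noncomputable def abel (u v : ℝ) : ENNReal := ENNReal.ofReal (√(u - v))⁻¹

theorem measurable_q (x : ℤˣ) : Measurable (q x) := by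
  unfold q
  split_ifs <;> fun_prop

theorem measurable_k (x : ℤˣ) : Measurable (k x) :=
  ((measurable_q x).sqrt.inv).ennreal_ofReal

theorem measurable_abel : Measurable fun p : ℝ × ℝ => abel p.1 p.2 :=
  ((measurable_fst.sub measurable_snd).sqrt.inv).ennreal_ofReal

theorem q_pos (x : ℤˣ) {v : ℝ} (hv : v ∈ Ioo (0 : ℝ) 1) : 0 < q x v := by
  unfold q
  split_ifs
  · exact hv.1
  · linarith [hv.2]

/-- The Möbius involution `w ↦ w'` of `(v, u)` with `q w * q w' = q u * q v`. -/
noncomputable def swapMap (x : ℤˣ) (u v w : ℝ) : ℝ :=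
  if x = 1 then u * v / w else 1 - (1 - u) * (1 - v) / (1 - w)

theorem q_swapMap (x : ℤˣ) (u v w : ℝ) : q x (swapMap x u v w) = q x u * q x v / q x w := by
  unfold q swapMap
  split_ifs <;> ring

theorem hasDerivAt_swapMap (x : ℤˣ) (u v : ℝ) {w : ℝ} (hw : q x w ≠ 0) :
    HasDerivAt (swapMap x u v) (-(q x u * q x v / q x w ^ 2)) w := by
  unfold q at hw ⊢
  unfold swapMap
  split_ifs with h
  · rw [if_pos h] at hw
    exact ((hasDerivAt_const w (u * v)).div (hasDerivAt_id w) hw).congr_deriv (by simp; ring)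
  · rw [if_neg h] at hw
    exact ((hasDerivAt_const w (1 : ℝ)).sub ((hasDerivAt_const w ((1 - u) * (1 - v))).div
      ((hasDerivAt_const w (1 : ℝ)).sub (hasDerivAt_id w)) hw)).congr_deriv (by simp)

/-- These two formulas show that the involution preserves the interval, and the first also says how
the Abel kernel transforms under it. -/
theorem swapMap_sub (x : ℤˣ) {u v w : ℝ} (hw : 0 < q x w) (hu : 0 < q x u) (hv : 0 < q x v) :
    (swapMap x u v w - v = q x v * (u - w) / q x w) ∧
      (u - swapMap x u v w = q x u * (w - v) / q x w) := by
  unfold q at *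
  unfold swapMap
  split_ifs at * with h
  · constructor <;> field_simp
  · constructor <;> field_simp <;> ring

theorem swapMap_mem (x : ℤˣ) {u v w : ℝ} (hw : 0 < q x w) (hu : 0 < q x u) (hv : 0 < q x v)
    (h : w ∈ Ioo v u) : swapMap x u v w ∈ Ioo v u := by
  obtain ⟨h1, h2⟩ := swapMap_sub x hw hu hv
  have g1 : 0 < q x v * (u - w) / q x w := div_pos (mul_pos hv (sub_pos.2 h.2)) hw
  have g2 : 0 < q x u * (w - v) / q x w := div_pos (mul_pos hu (sub_pos.2 h.1)) hw
  exact ⟨by linarith, by linarith⟩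

theorem swapMap_swapMap (x : ℤˣ) {u v w : ℝ} (hw : 0 < q x w) (hu : 0 < q x u) (hv : 0 < q x v) :
    swapMap x u v (swapMap x u v w) = w := by
  unfold q at *
  unfold swapMap
  split_ifs at * with h
  · field_simp
  · have : 1 - (1 - (1 - u) * (1 - v) / (1 - w)) = (1 - u) * (1 - v) / (1 - w) := by ring
    rw [this]
    field_simp
    ring

/-- Substitution of the involution `w ↦ swapMap y u v w`: its Jacobian `q u * q v / (q w) ^ 2` turns
the singularity at `v` into one at `u` and splits off the factor `q v ^ (-1/2)`. The condition on `q
y u` excludes `u = 1` for the sign `-1`, where the map degenerates. -/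
theorem lintegral_kernel (y : ℤˣ) {u v : ℝ} (hv : 0 < v) (hvu : v < u) (hu : u ≤ 1)
    (hq : 0 < q y u) :
    ∫⁻ w in Ioo v u, k y w * k y w * abel w v = k y v * ∫⁻ w in Ioo v u, k y w * abel u w := by
  have hqw : ∀ w ∈ Ico v u, 0 < q y w := fun w hw =>
    q_pos y ⟨hv.trans_le hw.1, hw.2.trans_le hu⟩
  have hqv : 0 < q y v := hqw v ⟨le_rfl, hvu⟩
  have himage : swapMap y u v '' Ioo v u = Ioo v u := by
    ext w
    constructor
    · rintro ⟨w, hw, rfl⟩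
      exact swapMap_mem y (hqw w ⟨hw.1.le, hw.2⟩) hq hqv hw
    · intro hw
      have := hqw w ⟨hw.1.le, hw.2⟩
      exact ⟨_, swapMap_mem y this hq hqv hw, swapMap_swapMap y this hq hqv⟩
  have hinj : InjOn (swapMap y u v) (Ioo v u) := by
    intro w hw w' hw' h
    rw [← swapMap_swapMap y (hqw w ⟨hw.1.le, hw.2⟩) hq hqv, h,
      swapMap_swapMap y (hqw w' ⟨hw'.1.le, hw'.2⟩) hq hqv]
  conv_lhs => rw [← himage]
  rw [lintegral_image_eq_lintegral_abs_deriv_mul measurableSet_Ioo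
    (fun w hw => (hasDerivAt_swapMap y u v (hqw w ⟨hw.1.le, hw.2⟩).ne').hasDerivWithinAt) hinj,
    ← lintegral_const_mul]
  · refine setLIntegral_congr_fun measurableSet_Ioo fun w hw => ?_
    have hw' := hqw w ⟨hw.1.le, hw.2⟩
    simp only [k, abel]
    rw [q_swapMap, (swapMap_sub y hw' hq hqv).1, ← ENNReal.ofReal_mul (by positivity),
      ← ENNReal.ofReal_mul (by positivity), ← ENNReal.ofReal_mul (by positivity),
      ← ENNReal.ofReal_mul (by positivity), ← ENNReal.ofReal_mul (by positivity)]
    congr 1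
    have huw : 0 < u - w := sub_pos.2 hw.2
    rw [abs_neg, abs_of_pos (by positivity), ← mul_inv, Real.mul_self_sqrt (by positivity),
      Real.sqrt_div (by positivity), Real.sqrt_mul hqv.le]
    have e1 : √(q y w) ≠ 0 := (Real.sqrt_pos.2 hw').ne'
    have e2 : √(q y v) ≠ 0 := (Real.sqrt_pos.2 hqv).ne'
    have e3 : √(u - w) ≠ 0 := (Real.sqrt_pos.2 huw).ne'
    have e4 := Real.mul_self_sqrt hw'.le
    field_simp
    nlinarith
  · exact (measurable_k y).mul (measurable_abel.comp (measurable_const.prodMk measurable_id))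

/-- The antiderivative is `arcsin (2 v / u - 1)`, which increases from `-π / 2` to `π / 2`; this is
the source of the factor `π` in the theorem. -/
theorem lintegral_arcsine {u : ℝ} (hu : 0 < u) :
    ∫⁻ v in Ioo 0 u, k 1 v * abel u v = ENNReal.ofReal Real.pi := by
  have hcont : ContinuousOn (fun v => Real.arcsin (2 * v / u - 1)) (Icc 0 u) :=
    (Real.continuous_arcsin.comp (by fun_prop)).continuousOn
  have hderiv : ∀ v ∈ Ioo 0 u, HasDerivAt (fun v => Real.arcsin (2 * v / u - 1))
      ((√v)⁻¹ * (√(u - v))⁻¹) v := by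
    intro v hv
    have h1 : 0 < v := hv.1
    have h2 : 0 < u - v := sub_pos.2 hv.2
    have h3 : 2 * v / u - 1 ≠ -1 := by
      have : 0 < 2 * v / u := by positivity
      linarith
    have h4 : 2 * v / u - 1 ≠ 1 := by
      have : 2 * v / u < 2 := by rw [div_lt_iff₀ hu]; linarith
      linarith
    have h5 : HasDerivAt (fun v => 2 * v / u - 1) (2 * 1 / u) v :=
      (((hasDerivAt_id v).const_mul 2).div_const u).sub_const 1
    refine ((Real.hasDerivAt_arcsin h3 h4).comp v h5).congr_deriv ?_
    have h6 : 1 - (2 * v / u - 1) ^ 2 = (2 / u) ^ 2 * (v * (u - v)) := by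
      field_simp; ring
    rw [h6, Real.sqrt_mul (by positivity), Real.sqrt_sq (by positivity), Real.sqrt_mul h1.le]
    field_simp
  have hpos : ∀ v ∈ Ioo 0 u, 0 ≤ (√v)⁻¹ * (√(u - v))⁻¹ := fun v _ => by positivity
  -- Despite both endpoint singularities, a nonnegative derivative of a function continuous up to
  -- the endpoints is integrable.
  have hint : IntegrableOn (fun v => (√v)⁻¹ * (√(u - v))⁻¹) (Ioc 0 u) :=
    intervalIntegral.integrableOn_deriv_of_nonneg hcont hderiv hpos
  have hI := intervalIntegral.integral_eq_sub_of_hasDerivAt_of_le hu.le hcont hderiv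
    ((intervalIntegrable_iff_integrableOn_Ioc_of_le hu.le).2 hint)
  have h1 : (2 * u / u - 1 : ℝ) = 1 := by field_simp; norm_num
  have h0 : (2 * 0 / u - 1 : ℝ) = -1 := by simp
  rw [h1, h0, Real.arcsin_one, Real.arcsin_neg_one, intervalIntegral.integral_of_le hu.le,
    integral_Ioc_eq_integral_Ioo] at hI
  have : Real.pi = Real.pi / 2 - -(Real.pi / 2) := by ring
  rw [this, ← hI, ofReal_integral_eq_lintegral_ofReal (hint.mono_set Ioo_subset_Ioc_self)
    ((ae_restrict_iff' measurableSet_Ioo).2 (Eventually.of_forall hpos))]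
  refine lintegral_congr fun v => ?_
  rw [k, abel, ENNReal.ofReal_mul (by positivity)]
  simp [q]

theorem lintegral_triangle_swap {G : ℝ → ℝ → ENNReal} (hG : Measurable fun p : ℝ × ℝ => G p.1 p.2)
    (u : ℝ) :
    ∫⁻ w in Ioo 0 u, ∫⁻ v in Ioo 0 w, G v w = ∫⁻ v in Ioo 0 u, ∫⁻ w in Ioo v u, G v w := by
  let S : Set (ℝ × ℝ) := {p | 0 < p.1 ∧ p.1 < p.2 ∧ p.2 < u}
  have hS : MeasurableSet S := (measurableSet_lt measurable_const measurable_fst).inter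
    ((measurableSet_lt measurable_fst measurable_snd).inter
      (measurableSet_lt measurable_snd measurable_const))
  have hm : Measurable (S.indicator fun p : ℝ × ℝ => G p.1 p.2) := hG.indicator hS
  have h1 : ∫⁻ w in Ioo 0 u, ∫⁻ v in Ioo 0 w, G v w =
      ∫⁻ w, ∫⁻ v, S.indicator (fun p : ℝ × ℝ => G p.1 p.2) (v, w) := by
    rw [← lintegral_indicator measurableSet_Ioo]
    refine lintegral_congr fun w => ?_
    by_cases hw : w ∈ Ioo 0 u
    · rw [indicator_of_mem hw, ← lintegral_indicator measurableSet_Ioo]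
      refine lintegral_congr fun v => ?_
      have : (v, w) ∈ S ↔ v ∈ Ioo 0 w := ⟨fun h => ⟨h.1, h.2.1⟩, fun h => ⟨h.1, h.2, hw.2⟩⟩
      simp only [indicator, this]
    · rw [indicator_of_notMem hw]
      symm
      refine (lintegral_congr fun v => ?_).trans lintegral_zero
      exact indicator_of_notMem (fun h => hw ⟨h.1.trans h.2.1, h.2.2⟩) _
  have h2 : ∫⁻ v in Ioo 0 u, ∫⁻ w in Ioo v u, G v w =
      ∫⁻ v, ∫⁻ w, S.indicator (fun p : ℝ × ℝ => G p.1 p.2) (v, w) := by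
    rw [← lintegral_indicator measurableSet_Ioo]
    refine lintegral_congr fun v => ?_
    by_cases hv : v ∈ Ioo 0 u
    · rw [indicator_of_mem hv, ← lintegral_indicator measurableSet_Ioo]
      refine lintegral_congr fun w => ?_
      have : (v, w) ∈ S ↔ w ∈ Ioo v u := ⟨fun h => h.2, fun h => ⟨hv.1, h⟩⟩
      by_cases h : w ∈ Ioo v u
      · rw [indicator_of_mem h, indicator_of_mem (this.2 h)]
      · rw [indicator_of_notMem h, indicator_of_notMem fun h' => h (this.1 h')]
    · rw [indicator_of_notMem hv]
      symm
      refine (lintegral_congr fun w => ?_).trans lintegral_zero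
      exact indicator_of_notMem (fun h => hv ⟨h.1, h.2.1.trans h.2.2⟩) _
  rw [h1, h2]
  exact lintegral_lintegral_swap (f := fun w v => S.indicator (fun p : ℝ × ℝ => G p.1 p.2) (v, w))
    (hm.comp measurable_swap).aemeasurable

/-- The Abel transform of the iterated integrals of the forms `q_{x_i}^{-1/2} q_{x_{i+1}}^{-1/2} dv`
gives the iterated integrals of the forms `q_{x_i}^{-1} dv`. -/
theorem abel_liter (x : ℕ → ℤˣ) (hx : x 0 = 1) (j : ℕ) {u : ℝ} (hu0 : 0 < u) (hu1 : u ≤ 1)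
    (hq : 0 < q (x j) u) :
    ENNReal.ofReal Real.pi * liter (fun i v => k (x (i + 1)) v * k (x (i + 1)) v) j 0 u =
      ∫⁻ v in Ioo 0 u, liter (fun i v => k (x i) v * k (x (i + 1)) v) j 0 v * k (x j) v *
        abel u v := by
  induction j generalizing u with
  | zero => simp [liter, hx, lintegral_arcsine hu0]
  | succ j ih =>
    set L : ℝ → ENNReal := liter (fun i v => k (x i) v * k (x (i + 1)) v) j 0 with hL
    have hLm : Measurable L := measurable_liter _ _ _
    have hx1 := measurable_k (x j)
    have hy := measurable_k (x (j + 1))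
    have hab := measurable_abel
    have hab1 : ∀ w, Measurable (abel w) := fun w =>
      hab.comp (measurable_const.prodMk measurable_id)
    have hab2 : ∀ v, Measurable fun w => abel w v := fun v =>
      hab.comp (measurable_id.prodMk measurable_const)
    rw [liter, ← lintegral_const_mul _ ((measurable_liter _ _ _).fun_mul (hy.fun_mul hy))]
    -- The induction hypothesis at `w` introduces a kernel with pole at `v`. After exchanging the
    -- integrals, the kernel identity moves the pole to `u`; exchanging back exposes the next letter
    -- of the left word inside. With values in `ENNReal` no integrability is needed.
    calc ∫⁻ w in Ioo 0 u, ENNReal.ofReal Real.pi *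
          (liter (fun i v => k (x (i + 1)) v * k (x (i + 1)) v) j 0 w *
            (k (x (j + 1)) w * k (x (j + 1)) w))
        = ∫⁻ w in Ioo 0 u, ∫⁻ v in Ioo 0 w,
            L v * k (x j) v * (k (x (j + 1)) w * k (x (j + 1)) w * abel w v) := by
          refine setLIntegral_congr_fun measurableSet_Ioo fun w hw => ?_
          rw [← mul_assoc, ih hw.1 (hw.2.le.trans hu1) (q_pos _ ⟨hw.1, hw.2.trans_le hu1⟩),
            ← lintegral_mul_const _ ((hLm.fun_mul hx1).fun_mul (hab1 w))]
          refine lintegral_congr fun v => ?_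
          ring
      _ = ∫⁻ v in Ioo 0 u, ∫⁻ w in Ioo v u,
            L v * k (x j) v * (k (x (j + 1)) w * k (x (j + 1)) w * abel w v) := by
          refine lintegral_triangle_swap
            (G := fun v w => L v * k (x j) v * (k (x (j + 1)) w * k (x (j + 1)) w * abel w v)) ?_ u
          exact ((hLm.comp measurable_fst).fun_mul (hx1.comp measurable_fst)).mul
            (((hy.comp measurable_snd).fun_mul (hy.comp measurable_snd)).mul
              (hab.comp measurable_swap))
      _ = ∫⁻ v in Ioo 0 u, ∫⁻ w in Ioo v u,
            L v * (k (x j) v * k (x (j + 1)) v) * (k (x (j + 1)) w * abel u w) := by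
          refine setLIntegral_congr_fun measurableSet_Ioo fun v hv => ?_
          rw [lintegral_const_mul _ ((hy.fun_mul hy).fun_mul (hab2 v)), lintegral_kernel _ hv.1 hv.2 hu1 hq,
            lintegral_const_mul _ (hy.fun_mul (hab1 u))]
          ring
      _ = ∫⁻ w in Ioo 0 u, ∫⁻ v in Ioo 0 w,
            L v * (k (x j) v * k (x (j + 1)) v) * (k (x (j + 1)) w * abel u w) := by
          symm
          refine lintegral_triangle_swap
            (G := fun v w => L v * (k (x j) v * k (x (j + 1)) v) *
              (k (x (j + 1)) w * abel u w)) ?_ u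
          exact ((hLm.comp measurable_fst).fun_mul ((hx1.comp measurable_fst).mul
            (hy.comp measurable_fst))).mul
            ((hy.comp measurable_snd).fun_mul ((hab1 u).comp measurable_snd))
      _ = _ := by
          refine lintegral_congr fun w => ?_
          rw [lintegral_mul_const _ (hLm.fun_mul (hx1.fun_mul hy)), liter, mul_assoc]

/-- Comparison of the two complete iterated integrals. -/
theorem liter_zero_one (x : ℕ → ℤˣ) (hx : x 0 = 1) (n : ℕ) (hn : x n = 1) (hn1 : x (n + 1) = -1) :
    liter (fun i v => k (x i) v * k (x (i + 1)) v) (n + 1) 0 1 =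
      ENNReal.ofReal Real.pi *
        liter (fun i v => k (x (i + 1)) v * k (x (i + 1)) v) n 0 1 := by
  rw [abel_liter x hx n one_pos le_rfl (by simp [q, hn]), liter]
  refine lintegral_congr fun v => ?_
  -- The last sign is `-1`, so its density is exactly the Abel kernel at the endpoint `1`.
  have : k (x (n + 1)) v = abel 1 v := by
    rw [hn1]
    simp [k, abel, q]
  rw [this, mul_assoc]

/-! ### Iterated integrals along regular paths -/

/-- The letters `ω_k(γ(t)) γ'(t)`. -/
noncomputable def letters (γ : ℝ → ℂ) (ω : ℕ → ℂ → ℂ) : ℕ → ℝ → ℂ :=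
  fun k t => ω k (γ t) * deriv γ t

/-- Paths along which holomorphic forms can be integrated over compact subintervals of `(0, 1)`. -/
structure RegularPath (γ : ℝ → ℂ) : Prop where
  cont : ContinuousOn γ (Ioo 0 1)
  diff : ∃ s : Set ℝ, s.Countable ∧ ∀ t ∈ Ioo (0 : ℝ) 1 \ s, DifferentiableAt ℝ γ t
  int : ∀ a ∈ Ioo (0 : ℝ) 1, ∀ b ∈ Ioo (0 : ℝ) 1, IntervalIntegrable (deriv γ) volume a b

theorem RegularPath.locInt {γ : ℝ → ℂ} (hγ : RegularPath γ) {U : Set ℂ}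
    (hU : MapsTo γ (Ioo 0 1) U) {ω : ℕ → ℂ → ℂ} (hω : ∀ k, ContinuousOn (ω k) U) :
    LocInt (letters γ ω) := fun k a ha b hb =>
  (hγ.int a ha b hb).continuousOn_mul
    (((hω k).comp hγ.cont hU).mono (uIcc_subset_Ioo ha hb))

/-- The fundamental theorem of calculus tolerates a countable exceptional set, which accommodates
the corners of the path. -/
theorem isRow_of_hasDerivAt {φ R : ℕ → ℝ → ℂ} {a b : ℝ} {s : Set ℝ} (hs : s.Countable)
    (hφ : ∀ k, IntervalIntegrable (φ k) volume a b) (h0 : ∀ t ∈ uIcc a b, R 0 t = R 0 a)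
    (hc : ∀ k, ContinuousOn (R k) (uIcc a b))
    (hd : ∀ k, ∀ t ∈ uIcc a b \ s, HasDerivAt (R (k + 1)) (R k t * φ k t) t) :
    IsRow φ R a b := by
  refine ⟨h0, fun k t ht => ?_⟩
  have hsub : uIcc a t ⊆ uIcc a b := uIcc_subset_uIcc_left ht
  rw [integral_eq_of_hasDerivAt_off_countable (R (k + 1)) _ hs ((hc _).mono hsub)
    (fun u hu => hd k u ⟨hsub (Ioo_subset_Icc_self hu.1), hu.2⟩)
    (((hφ k).mono_set hsub).continuousOn_mul ((hc k).mono hsub))]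
  ring

/-- `σ` is a horizontal holomorphic section on `W` of the connection given by the forms `ω`. -/
def IsSection (ω σ : ℕ → ℂ → ℂ) (W : Set ℂ) : Prop :=
  (∃ c, ∀ z ∈ W, σ 0 z = c) ∧ ∀ k, ∀ z ∈ W, HasDerivAt (σ (k + 1)) (σ k z * ω k z) z

theorem IsSection.mono {ω σ : ℕ → ℂ → ℂ} {W W' : Set ℂ} (h : IsSection ω σ W) (hW : W' ⊆ W) :
    IsSection ω σ W' :=
  ⟨h.1.imp fun _ hc z hz => hc z (hW hz), fun k z hz => h.2 k z (hW hz)⟩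

theorem IsSection.continuousOn {ω σ : ℕ → ℂ → ℂ} {W : Set ℂ} (h : IsSection ω σ W) (k : ℕ) :
    ContinuousOn (σ k) W := by
  cases k with
  | zero =>
    obtain ⟨c, hc⟩ := h.1
    exact continuousOn_const.congr hc
  | succ k => exact fun z hz => (h.2 k z hz).continuousAt.continuousWithinAt

theorem IsSection.isRow {ω σ : ℕ → ℂ → ℂ} {W : Set ℂ} (h : IsSection ω σ W) {γ : ℝ → ℂ}
    (hγ : RegularPath γ) (hφ : LocInt (letters γ ω)) {a b : ℝ} (ha : a ∈ Ioo (0 : ℝ) 1)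
    (hb : b ∈ Ioo (0 : ℝ) 1) (hW : MapsTo γ (uIcc a b) W) :
    IsRow (letters γ ω) (fun k t => σ k (γ t)) a b := by
  have hsub := uIcc_subset_Ioo ha hb
  obtain ⟨c, hc⟩ := h.1
  obtain ⟨s, hs, hd⟩ := hγ.diff
  refine isRow_of_hasDerivAt hs (fun k => hφ k a ha b hb)
    (fun t ht => (hc _ (hW ht)).trans (hc _ (hW left_mem_uIcc)).symm)
    (fun k => (h.continuousOn k).comp (hγ.cont.mono hsub) hW) fun k t ht => ?_
  have := (h.2 k _ (hW ht.1)).comp t (hd t ⟨hsub ht.1, ht.2⟩).hasDerivAt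
  exact this.congr_deriv (by simp [letters, mul_assoc])

/-- The primitive on a disc of a holomorphic function, normalized at the centre. -/
theorem exists_primitive {p : ℂ} {r : ℝ} {f : ℂ → ℂ} (hf : DifferentiableOn ℂ f (Metric.ball p r))
    (v : ℂ) : ∃ F : ℂ → ℂ, F p = v ∧ ∀ z ∈ Metric.ball p r, HasDerivAt F (f z) z := by
  obtain ⟨g, hg⟩ := hf.isExactOn_ball
  exact ⟨fun z => g z - g p + v, by simp, fun z hz => ((hg z hz).sub_const _).add_const _⟩

theorem differentiableOn_of_hasDerivAt {F f : ℂ → ℂ} {W : Set ℂ}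
    (h : ∀ z ∈ W, HasDerivAt F (f z) z) : DifferentiableOn ℂ F W :=
  fun z hz => (h z hz).differentiableAt.differentiableWithinAt

theorem differentiableOn_dslope_ball {p : ℂ} {d : ℂ → ℂ}
    (hd : DifferentiableOn ℂ d (Metric.ball p 1)) :
    DifferentiableOn ℂ (dslope d p) (Metric.ball p 1) :=
  (Complex.differentiableOn_dslope (Metric.ball_mem_nhds p one_pos)).2 hd

/-- The forms `ω_k` have at most a simple pole at the centre of the unit disc around `p`. -/
def SimplePoles (ω : ℕ → ℂ → ℂ) (p : ℂ) (c : ℕ → ℂ) (g : ℕ → ℂ → ℂ) : Prop :=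
  ∀ k, DifferentiableOn ℂ (g k) (Metric.ball p 1) ∧
    ∀ z ∈ Metric.ball p 1, z ≠ p → ω k z = c k / (z - p) + g k z

/-- A section on a punctured disc that extends to the disc and is `(1, 0, 0, …)` at its centre. -/
structure IsBasicSection (ω : ℕ → ℂ → ℂ) (p : ℂ) (ρ : ℕ → ℂ → ℂ) : Prop where
  zero : ∀ z, ρ 0 z = 1
  diff : ∀ k, DifferentiableOn ℂ (ρ k) (Metric.ball p 1)
  center : ∀ k, ρ (k + 1) p = 0
  deriv : ∀ k, ∀ z ∈ Metric.ball p 1, z ≠ p → HasDerivAt (ρ (k + 1)) (ρ k z * ω k z) z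

theorem IsBasicSection.isSection {ω ρ : ℕ → ℂ → ℂ} {p : ℂ} (h : IsBasicSection ω p ρ) {W : Set ℂ}
    (hW : W ⊆ Metric.ball p 1) (hp : p ∉ W) : IsSection ω ρ W :=
  ⟨⟨1, fun z _ => h.zero z⟩, fun k z hz => h.deriv k z (hW hz) fun e => hp (e ▸ hz)⟩

/-- If the first form is regular at `p`, then the section that is trivial at `p` is holomorphic. -/
theorem exists_isBasicSection {ω : ℕ → ℂ → ℂ} {p : ℂ} {c : ℕ → ℂ} {g : ℕ → ℂ → ℂ}
    (hω : SimplePoles ω p c g) (h0 : c 0 = 0) : ∃ ρ, IsBasicSection ω p ρ := by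
  have hstep : ∀ (k : ℕ) (f : {f : ℂ → ℂ // DifferentiableOn ℂ f (Metric.ball p 1)}),
      ∃ F : {f : ℂ → ℂ // DifferentiableOn ℂ f (Metric.ball p 1)}, F.1 p = 0 ∧
        ∀ z ∈ Metric.ball p 1, HasDerivAt F.1 (c k * dslope f.1 p z + f.1 z * g k z) z := by
    rintro k ⟨f, hf⟩
    obtain ⟨F, hF0, hF⟩ := exists_primitive (f := fun z => c k * dslope f p z + f z * g k z)
      (((differentiableOn_dslope_ball hf).const_mul (c k)).add (hf.mul (hω k).1)) 0
    exact ⟨⟨F, differentiableOn_of_hasDerivAt hF⟩, hF0, hF⟩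
  choose next hnext0 hnext using hstep
  let ρ : ℕ → {f : ℂ → ℂ // DifferentiableOn ℂ f (Metric.ball p 1)} := fun k =>
    Nat.rec ⟨fun _ => 1, differentiableOn_const 1⟩ next k
  refine ⟨fun k => (ρ k).1, fun _ => rfl, fun k => (ρ k).2, fun k => hnext0 k (ρ k),
    fun k z hz hzp => (hnext k (ρ k) z hz).congr_deriv ?_⟩
  have hs := sub_smul_dslope (ρ k).1 p z
  have hz' : z - p ≠ 0 := sub_ne_zero.2 hzp
  rw [(hω k).2 z hz hzp]
  -- No pole arises in either case: for `k = 0` the residue `c 0` vanishes, and for larger `k` the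
  -- section vanishes at `p`, so its quotient by `z - p` is the `dslope`.
  cases k with
  | zero => simp [h0]
  | succ k =>
    have h1 : (ρ (k + 1)).1 p = 0 := hnext0 k (ρ k)
    rw [h1, sub_zero, smul_eq_mul] at hs
    rw [← hs]
    field_simp

/-! ### Growth near a puncture -/

/-- Near `t` a continuous branch differs by a constant from the principal logarithm of `f s / f t`,
because the imaginary part of `ℓ s - ℓ t` is small. -/
theorem hasDerivAt_of_exp {ℓ f : ℝ → ℂ} {f' : ℂ} {t : ℝ} (hc : ContinuousAt ℓ t)
    (he : ∀ᶠ s in 𝓝 t, Complex.exp (ℓ s) = f s) (hf : HasDerivAt f f' t) :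
    HasDerivAt ℓ (f' / f t) t := by
  have het := he.self_of_nhds
  have hne : f t ≠ 0 := het ▸ Complex.exp_ne_zero _
  have h1 : HasDerivAt (fun s => ℓ t + Complex.log (f s / f t)) (f' / f t) t := by
    refine (((hf.div_const (f t)).clog_real (by simp [hne])).const_add _).congr_deriv ?_
    rw [div_self hne, div_one]
  refine h1.congr_of_eventuallyEq ?_
  have h2 : Tendsto (fun s => (ℓ s - ℓ t).im) (𝓝 t) (𝓝 0) := by
    have : ContinuousAt (fun s => (ℓ s - ℓ t).im) t :=
      Complex.continuous_im.continuousAt.comp (hc.sub continuousAt_const)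
    simpa [ContinuousAt] using this
  filter_upwards [he, h2 (Ioo_mem_nhds (neg_lt_zero.2 Real.pi_pos) Real.pi_pos)] with s hs1 hs2
  rw [← hs1, ← het, ← Complex.exp_sub, Complex.log_exp hs2.1 (le_of_lt hs2.2)]
  ring

/-- A path that emanates from `p`, with a branch `ℓ` of `log (γ - p)` of bounded imaginary part;
up to the time `b` the path stays in the unit disc around `p`. -/
structure EmanatesFrom (γ : ℝ → ℂ) (p : ℂ) (ℓ : ℝ → ℂ) (b : ℝ) : Prop where
  reg : RegularPath γ
  time : b ∈ Ioo (0 : ℝ) 1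
  mem : ∀ t ∈ Ioc 0 b, γ t ∈ Metric.ball p 1
  lim : Tendsto γ (𝓝[>] 0) (𝓝 p)
  cont_log : ContinuousOn ℓ (Ioo 0 1)
  exp_log : ∀ t ∈ Ioo (0 : ℝ) 1, Complex.exp (ℓ t) = γ t - p
  bound : ∃ C, ∀ t ∈ Ioo (0 : ℝ) 1, ‖ℓ t‖ ≤ C + |Real.log ‖γ t - p‖|

theorem EmanatesFrom.ne {γ ℓ : ℝ → ℂ} {p : ℂ} {b : ℝ} (h : EmanatesFrom γ p ℓ b) {t : ℝ}
    (ht : t ∈ Ioo (0 : ℝ) 1) : γ t ≠ p :=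
  sub_ne_zero.1 (h.exp_log t ht ▸ Complex.exp_ne_zero _)

theorem EmanatesFrom.Ioc_subset {γ ℓ : ℝ → ℂ} {p : ℂ} {b : ℝ} (h : EmanatesFrom γ p ℓ b) :
    Ioc 0 b ⊆ Ioo (0 : ℝ) 1 := fun _ ht => ⟨ht.1, ht.2.trans_lt h.time.2⟩

/-- Polynomials in `ℓ` whose coefficients are holomorphic functions of `γ`. -/
def logPoly (γ ℓ : ℝ → ℂ) (p : ℂ) : Submodule ℂ (ℝ → ℂ) :=
  Submodule.span ℂ {f | ∃ (d : ℂ → ℂ) (m : ℕ), DifferentiableOn ℂ d (Metric.ball p 1) ∧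
    f = fun t => d (γ t) * ℓ t ^ m}

/-- Split `d(z) / (z - p)` into `d(p) / (z - p)` and the holomorphic `dslope`. The first part
integrates to a higher power of `ℓ`; the rest is integrated by parts, which lowers the power of `ℓ`.
-/
theorem EmanatesFrom.exists_primitive_monomial {γ ℓ : ℝ → ℂ} {p : ℂ} {b : ℝ}
    (h : EmanatesFrom γ p ℓ b) {s : Set ℝ}
    (hs : ∀ t ∈ Ioo (0 : ℝ) 1 \ s, DifferentiableAt ℝ γ t) (m : ℕ) :
    ∀ (d g : ℂ → ℂ) (c : ℂ), DifferentiableOn ℂ d (Metric.ball p 1) →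
      DifferentiableOn ℂ g (Metric.ball p 1) → ∃ F ∈ logPoly γ ℓ p, ∀ t ∈ Ioc 0 b \ s,
        HasDerivAt F (d (γ t) * ℓ t ^ m * ((c / (γ t - p) + g (γ t)) * deriv γ t)) t := by
  have hℓ : ∀ t ∈ Ioc 0 b \ s, HasDerivAt ℓ (deriv γ t / (γ t - p)) t := by
    intro t ht
    have ht' := h.Ioc_subset ht.1
    refine hasDerivAt_of_exp (f := fun t => γ t - p) (h.cont_log.continuousAt (isOpen_Ioo.mem_nhds ht')) ?_
      ((hs t ⟨ht', ht.2⟩).hasDerivAt.sub_const p)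
    filter_upwards [isOpen_Ioo.mem_nhds ht'] with u hu using h.exp_log u hu
  induction m with
  | zero =>
    intro d g c hd hg
    obtain ⟨G, -, hG⟩ := exists_primitive (f := fun z => c * dslope d p z + d z * g z)
      (((differentiableOn_dslope_ball hd).const_mul c).add (hd.mul hg)) 0
    refine ⟨(fun t => (c * d p) * ℓ t ^ 1) + fun t => G (γ t) * ℓ t ^ 0, Submodule.add_mem _
      (Submodule.subset_span ⟨fun _ => c * d p, 1, differentiableOn_const _, rfl⟩)
      (Submodule.subset_span ⟨G, 0, differentiableOn_of_hasDerivAt hG, rfl⟩), fun t ht => ?_⟩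
    have ht' := h.Ioc_subset ht.1
    have hne := sub_ne_zero.2 (h.ne ht')
    have h1 := (hG _ (h.mem t ht.1)).comp t (hs t ⟨ht', ht.2⟩).hasDerivAt
    have h2 := (hℓ t ht).const_mul (c * d p)
    have h3 := sub_smul_dslope d p (γ t)
    rw [smul_eq_mul] at h3
    simp only [pow_one, pow_zero, mul_one]
    refine (h2.add h1).congr_deriv ?_
    have h4 : d (γ t) = d p + (γ t - p) * dslope d p (γ t) := by rw [h3]; ring
    generalize dslope d p (γ t) = D at *
    rw [h4]
    field_simp
    ring
  | succ m ih =>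
    intro d g c hd hg
    obtain ⟨G, -, hG⟩ := exists_primitive (f := fun z => c * dslope d p z + d z * g z)
      (((differentiableOn_dslope_ball hd).const_mul c).add (hd.mul hg)) 0
    have hGd := differentiableOn_of_hasDerivAt hG
    -- `F` is the correction term of the integration by parts: it integrates `G` times the
    -- derivative of `ℓ ^ (m + 1)`, a form with residue constant `m + 1` and no regular part.
    obtain ⟨F, hF, hFd⟩ := ih G (fun _ => 0) (m + 1) hGd (differentiableOn_const _)
    refine ⟨(fun t => (c * d p / (m + 2)) * ℓ t ^ (m + 2)) + (fun t => G (γ t) * ℓ t ^ (m + 1)) - F,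
      Submodule.sub_mem _ (Submodule.add_mem _
      (Submodule.subset_span ⟨fun _ => c * d p / (m + 2), m + 2, differentiableOn_const _, rfl⟩)
      (Submodule.subset_span ⟨G, m + 1, hGd, rfl⟩)) hF, fun t ht => ?_⟩
    have ht' := h.Ioc_subset ht.1
    have hne := sub_ne_zero.2 (h.ne ht')
    have h1 := (hG _ (h.mem t ht.1)).comp t (hs t ⟨ht', ht.2⟩).hasDerivAt
    have h2 := ((hℓ t ht).fun_pow (m + 2)).const_mul (c * d p / (m + 2))
    have h3 := sub_smul_dslope d p (γ t)
    rw [smul_eq_mul] at h3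
    refine ((h2.add (h1.mul ((hℓ t ht).fun_pow (m + 1)))).sub (hFd t ht)).congr_deriv ?_
    have h4 : d (γ t) = d p + (γ t - p) * dslope d p (γ t) := by rw [h3]; ring
    have h5 : ((m : ℂ) + 2) ≠ 0 := by exact_mod_cast (by omega : m + 2 ≠ 0)
    simp only [Function.comp, Nat.add_succ_sub_one, Nat.cast_add, Nat.cast_one, Nat.cast_ofNat]
    generalize dslope d p (γ t) = D at *
    rw [h4]
    field_simp
    ring

theorem EmanatesFrom.exists_primitive_logPoly {γ ℓ : ℝ → ℂ} {p : ℂ} {b : ℝ}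
    (h : EmanatesFrom γ p ℓ b) {s : Set ℝ}
    (hs : ∀ t ∈ Ioo (0 : ℝ) 1 \ s, DifferentiableAt ℝ γ t) {f : ℝ → ℂ} (hf : f ∈ logPoly γ ℓ p)
    (g : ℂ → ℂ) (c : ℂ) (hg : DifferentiableOn ℂ g (Metric.ball p 1)) :
    ∃ F ∈ logPoly γ ℓ p, ∀ t ∈ Ioc 0 b \ s,
      HasDerivAt F (f t * ((c / (γ t - p) + g (γ t)) * deriv γ t)) t := by
  induction hf using Submodule.span_induction with
  | mem f hf =>
    obtain ⟨d, m, hd, rfl⟩ := hf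
    exact h.exists_primitive_monomial hs m d g c hd hg
  | zero => exact ⟨0, Submodule.zero_mem _, fun t _ => by simp⟩
  | add f₁ f₂ _ _ h₁ h₂ =>
    obtain ⟨F₁, m₁, d₁⟩ := h₁
    obtain ⟨F₂, m₂, d₂⟩ := h₂
    refine ⟨F₁ + F₂, Submodule.add_mem _ m₁ m₂, fun t ht => ?_⟩
    exact ((d₁ t ht).add (d₂ t ht)).congr_deriv (by simp only [Pi.add_apply]; ring)
  | smul a f _ h₁ =>
    obtain ⟨F₁, m₁, d₁⟩ := h₁
    refine ⟨a • F₁, Submodule.smul_mem _ a m₁, fun t ht => ?_⟩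
    exact ((d₁ t ht).const_smul a).congr_deriv (by simp only [Pi.smul_apply, smul_eq_mul]; ring)

theorem EmanatesFrom.continuousOn_logPoly {γ ℓ : ℝ → ℂ} {p : ℂ} {b : ℝ}
    (h : EmanatesFrom γ p ℓ b) {f : ℝ → ℂ} (hf : f ∈ logPoly γ ℓ p) :
    ContinuousOn f (Ioc 0 b) := by
  induction hf using Submodule.span_induction with
  | mem f hf =>
    obtain ⟨d, m, hd, rfl⟩ := hf
    exact (hd.continuousOn.comp (h.reg.cont.mono h.Ioc_subset) h.mem).mul
      ((h.cont_log.mono h.Ioc_subset).pow m)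
  | zero => exact continuousOn_const
  | add f₁ f₂ _ _ h₁ h₂ => exact h₁.add h₂
  | smul a f _ h₁ => exact h₁.const_smul a

/-- Functions that grow at most like a power of `1 + ‖ℓ‖` at time `0`. -/
def Tempered (ℓ f : ℝ → ℂ) : Prop :=
  ∃ (C : ℝ) (N : ℕ), ∀ᶠ t in 𝓝[>] (0 : ℝ), ‖f t‖ ≤ C * (1 + ‖ℓ t‖) ^ N

theorem Tempered.congr {ℓ f f' : ℝ → ℂ} (hf : Tempered ℓ f) (h : ∀ᶠ t in 𝓝[>] (0 : ℝ), f' t = f t) :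
    Tempered ℓ f' := by
  obtain ⟨C, N, hC⟩ := hf
  refine ⟨C, N, ?_⟩
  filter_upwards [hC, h] with t h1 h2
  rwa [h2]

theorem tempered_const (ℓ : ℝ → ℂ) (c : ℂ) : Tempered ℓ fun _ => c :=
  ⟨‖c‖, 0, by simp⟩

theorem Tempered.add {ℓ f₁ f₂ : ℝ → ℂ} (h₁ : Tempered ℓ f₁) (h₂ : Tempered ℓ f₂) :
    Tempered ℓ fun t => f₁ t + f₂ t := by
  obtain ⟨C₁, N₁, h₁⟩ := h₁
  obtain ⟨C₂, N₂, h₂⟩ := h₂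
  refine ⟨|C₁| + |C₂|, N₁ + N₂, ?_⟩
  filter_upwards [h₁, h₂] with t g₁ g₂
  have hone : 1 ≤ 1 + ‖ℓ t‖ := le_add_of_nonneg_right (norm_nonneg _)
  have e₁ : C₁ * (1 + ‖ℓ t‖) ^ N₁ ≤ |C₁| * (1 + ‖ℓ t‖) ^ (N₁ + N₂) :=
    mul_le_mul (le_abs_self _) (pow_le_pow_right₀ hone (by omega)) (by positivity) (abs_nonneg _)
  have e₂ : C₂ * (1 + ‖ℓ t‖) ^ N₂ ≤ |C₂| * (1 + ‖ℓ t‖) ^ (N₁ + N₂) :=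
    mul_le_mul (le_abs_self _) (pow_le_pow_right₀ hone (by omega)) (by positivity) (abs_nonneg _)
  calc ‖f₁ t + f₂ t‖ ≤ ‖f₁ t‖ + ‖f₂ t‖ := norm_add_le _ _
    _ ≤ _ := by rw [add_mul]; linarith

theorem Tempered.mul {ℓ f₁ f₂ : ℝ → ℂ} (h₁ : Tempered ℓ f₁) (h₂ : Tempered ℓ f₂) :
    Tempered ℓ fun t => f₁ t * f₂ t := by
  obtain ⟨C₁, N₁, h₁⟩ := h₁
  obtain ⟨C₂, N₂, h₂⟩ := h₂
  refine ⟨C₁ * C₂, N₁ + N₂, ?_⟩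
  filter_upwards [h₁, h₂] with t g₁ g₂
  rw [norm_mul, pow_add, mul_mul_mul_comm]
  exact mul_le_mul g₁ g₂ (norm_nonneg _) ((norm_nonneg _).trans g₁)

theorem tempered_sum {ℓ : ℝ → ℂ} {ι : Type*} (S : Finset ι) {f : ι → ℝ → ℂ}
    (hf : ∀ i ∈ S, Tempered ℓ (f i)) : Tempered ℓ fun t => ∑ i ∈ S, f i t := by
  classical
  induction S using Finset.induction_on with
  | empty => simp [tempered_const ℓ 0]
  | insert i S hi ih =>
    simp only [Finset.sum_insert hi]
    exact (hf i (Finset.mem_insert_self i S)).add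
      (ih fun j hj => hf j (Finset.mem_insert_of_mem hj))

theorem EmanatesFrom.tempered_comp {γ ℓ : ℝ → ℂ} {p : ℂ} {b : ℝ} (h : EmanatesFrom γ p ℓ b)
    {d : ℂ → ℂ} (hd : ContinuousAt d p) : Tempered ℓ fun t => d (γ t) := by
  have h1 : Tendsto (fun t => ‖d (γ t)‖) (𝓝[>] 0) (𝓝 ‖d p‖) := (hd.tendsto.comp h.lim).norm
  refine ⟨‖d p‖ + 1, 0, ?_⟩
  filter_upwards [h1.eventually_le_const (lt_add_one ‖d p‖)] with t ht
  simpa using ht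

theorem EmanatesFrom.tempered_logPoly {γ ℓ : ℝ → ℂ} {p : ℂ} {b : ℝ} (h : EmanatesFrom γ p ℓ b)
    {f : ℝ → ℂ} (hf : f ∈ logPoly γ ℓ p) : Tempered ℓ f := by
  induction hf using Submodule.span_induction with
  | mem f hf =>
    obtain ⟨d, m, hd, rfl⟩ := hf
    refine (h.tempered_comp (hd.continuousOn.continuousAt
      (Metric.ball_mem_nhds p one_pos))).mul ⟨1, m, Eventually.of_forall fun t => ?_⟩
    rw [norm_pow, one_mul]
    exact pow_le_pow_left₀ (norm_nonneg _) (le_add_of_nonneg_left zero_le_one) _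
  | zero => exact tempered_const ℓ 0
  | add f₁ f₂ _ _ h₁ h₂ => exact h₁.add h₂
  | smul a f _ h₁ => exact (tempered_const ℓ a).mul h₁

theorem SimplePoles.shift {ω : ℕ → ℂ → ℂ} {p : ℂ} {c : ℕ → ℂ} {g : ℕ → ℂ → ℂ}
    (h : SimplePoles ω p c g) (j : ℕ) :
    SimplePoles (fun i => ω (i + j)) p (fun i => c (i + j)) (fun i => g (i + j)) :=
  fun k => h (k + j)

/-- A horizontal section along the path near the puncture, given by log-polynomials. -/
theorem EmanatesFrom.exists_row {γ ℓ : ℝ → ℂ} {p : ℂ} {b : ℝ} (h : EmanatesFrom γ p ℓ b)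
    {ω : ℕ → ℂ → ℂ} {c : ℕ → ℂ} {g : ℕ → ℂ → ℂ} (hω : SimplePoles ω p c g)
    (hφ : LocInt (letters γ ω)) :
    ∃ M : ℕ → ℝ → ℂ, (∀ t, M 0 t = 1) ∧ (∀ k, M k ∈ logPoly γ ℓ p) ∧
      ∀ a ∈ Ioc 0 b, IsRow (letters γ ω) M a b := by
  obtain ⟨s, hs, hd⟩ := h.reg.diff
  choose next hnext using fun (k : ℕ) (f : logPoly γ ℓ p) =>
    h.exists_primitive_logPoly hd f.2 (g k) (c k) (hω k).1
  let M : ℕ → logPoly γ ℓ p := fun k => Nat.rec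
    ⟨fun _ => 1, Submodule.subset_span ⟨fun _ => 1, 0, differentiableOn_const _, by simp⟩⟩
    (fun k f => ⟨next k f, (hnext k f).1⟩) k
  refine ⟨fun k => (M k).1, fun _ => rfl, fun k => (M k).2, fun a ha => ?_⟩
  have hsub : uIcc a b ⊆ Ioc 0 b := by
    rw [uIcc_of_le ha.2]
    exact Icc_subset_Ioc ha.1 le_rfl
  refine isRow_of_hasDerivAt hs (fun k => hφ k a (h.Ioc_subset ha) b h.time) (fun _ _ => rfl)
    (fun k => (h.continuousOn_logPoly (M k).2).mono hsub) fun k t ht => ?_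
  have ht' := hsub ht.1
  refine ((hnext k (M k)).2 t ⟨ht', ht.2⟩).congr_deriv ?_
  rw [letters, (hω k).2 _ (h.mem t ht') (h.ne (h.Ioc_subset ht'))]

theorem EmanatesFrom.eventually_mem {γ ℓ : ℝ → ℂ} {p : ℂ} {b : ℝ} (h : EmanatesFrom γ p ℓ b) :
    ∀ᶠ a in 𝓝[>] (0 : ℝ), a ∈ Ioc 0 b := Ioc_mem_nhdsGT h.time.1

/-- The transport formula for a log-polynomial row starting with `1` expresses the iterated integral
through tempered functions and integrals of shorter words. The forms vary in the statement because
these shorter words are final segments. Residues are arbitrary here: final segments may begin with a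
singular letter. -/
theorem EmanatesFrom.tempered_iter {γ ℓ : ℝ → ℂ} {p : ℂ} {b : ℝ} (h : EmanatesFrom γ p ℓ b) (m : ℕ) :
    ∀ {ω : ℕ → ℂ → ℂ} {c : ℕ → ℂ} {g : ℕ → ℂ → ℂ}, SimplePoles ω p c g → LocInt (letters γ ω) →
      Tempered ℓ fun a => iter (letters γ ω) m a b := by
  induction m using Nat.strong_induction_on with
  | _ m ih =>
    intro ω c g hω hφ
    obtain ⟨M, hM0, hM, hMr⟩ := h.exists_row hω hφ
    have key : ∀ᶠ a in 𝓝[>] (0 : ℝ), iter (letters γ ω) m a b = M m b + (-1) * ∑ k ∈ Finset.range m,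
        M (k + 1) a * iter (letters γ fun i => ω (i + (k + 1))) (m - (k + 1)) a b := by
      filter_upwards [h.eventually_mem] with a ha
      have h1 := (hMr a ha).eq_sum (fun k => hφ k a (h.Ioc_subset ha) b h.time) m b right_mem_uIcc
      rw [Finset.sum_range_succ', hM0, one_mul] at h1
      have h2 : M m b = ∑ k ∈ Finset.range m, M (k + 1) a *
          iter (letters γ fun i => ω (i + (k + 1))) (m - (k + 1)) a b +
          iter (letters γ ω) m a b := h1
      rw [h2]
      ring
    refine Tempered.congr ((tempered_const ℓ _).add ((tempered_const ℓ (-1)).mul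
      (tempered_sum _ fun k hk => (h.tempered_logPoly (hM _)).mul ?_))) key
    have hk' := Finset.mem_range.1 hk
    exact ih _ (by omega) (hω.shift (k + 1)) (hφ.shift (k + 1))

/-- With `X = 1 + |K| - log ‖γ t - p‖`, bounded argument gives `1 + ‖ℓ t‖ ≤ X` near the endpoint,
while `‖γ t - p‖` is a constant times `exp (-X)`; so exponential decay beats the power of `X`. -/
theorem EmanatesFrom.tendsto_mul_tempered {γ ℓ : ℝ → ℂ} {p : ℂ} {b : ℝ} (h : EmanatesFrom γ p ℓ b)
    {f : ℝ → ℂ} (hf : Tempered ℓ f) : Tendsto (fun t => (γ t - p) * f t) (𝓝[>] 0) (𝓝 0) := by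
  obtain ⟨C, N, hC⟩ := hf
  obtain ⟨K, hK⟩ := h.bound
  have hev : ∀ᶠ t in 𝓝[>] (0 : ℝ), t ∈ Ioo (0 : ℝ) 1 := Ioo_mem_nhdsGT one_pos
  have h0 : Tendsto (fun t => ‖γ t - p‖) (𝓝[>] 0) (𝓝[>] 0) := by
    refine tendsto_nhdsWithin_iff.2 ⟨?_, ?_⟩
    · have := (h.lim.sub_const p).norm
      simpa using this
    · filter_upwards [hev] with t ht
      exact norm_pos_iff.2 (sub_ne_zero.2 (h.ne ht))
  have h1 : Tendsto (fun t => 1 + |K| - Real.log ‖γ t - p‖) (𝓝[>] 0) atTop := by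
    have := tendsto_neg_atBot_atTop.comp (Real.tendsto_log_nhdsGT_zero.comp h0)
    simpa [sub_eq_add_neg, Function.comp_def] using tendsto_atTop_add_const_left _ (1 + |K|) this
  have h2 := ((Real.tendsto_pow_mul_exp_neg_atTop_nhds_zero N).comp h1).const_mul
    (|C| * Real.exp (1 + |K|))
  rw [mul_zero] at h2
  refine squeeze_zero_norm' ?_ h2
  filter_upwards [hC, hev, h0 (Ioo_mem_nhdsGT one_pos)] with t g1 g2 g3
  have g3' : ‖γ t - p‖ ∈ Ioo (0 : ℝ) 1 := g3
  have g4 : Real.log ‖γ t - p‖ < 0 := Real.log_neg g3'.1 g3'.2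
  have g5 := hK t g2
  rw [abs_of_neg g4] at g5
  have g6 : 1 + ‖ℓ t‖ ≤ 1 + |K| - Real.log ‖γ t - p‖ := by linarith [le_abs_self K]
  have g7 : Real.exp (-(1 + |K| - Real.log ‖γ t - p‖)) * Real.exp (1 + |K|) = ‖γ t - p‖ := by
    rw [← Real.exp_add, neg_sub, sub_add_cancel, Real.exp_log g3'.1]
  have g8 : ‖f t‖ ≤ |C| * (1 + |K| - Real.log ‖γ t - p‖) ^ N := by
    refine g1.trans (mul_le_mul (le_abs_self _) (pow_le_pow_left₀ (by positivity) g6 _)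
      (by positivity) (abs_nonneg _))
  rw [norm_mul]
  simp only [Function.comp]
  calc ‖γ t - p‖ * ‖f t‖ ≤ ‖γ t - p‖ * (|C| * (1 + |K| - Real.log ‖γ t - p‖) ^ N) :=
        mul_le_mul_of_nonneg_left g8 (norm_nonneg _)
    _ = |C| * (1 + |K| - Real.log ‖γ t - p‖) ^ N *
          (Real.exp (-(1 + |K| - Real.log ‖γ t - p‖)) * Real.exp (1 + |K|)) := by
      rw [g7]
      ring
    _ = _ := by ring

/-- Convergence of the iterated integrals at the initial point of the path. -/
theorem EmanatesFrom.tendsto_iter {γ ℓ : ℝ → ℂ} {p : ℂ} {b : ℝ} (h : EmanatesFrom γ p ℓ b)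
    {ω : ℕ → ℂ → ℂ} {c : ℕ → ℂ} {g : ℕ → ℂ → ℂ} (hω : SimplePoles ω p c g)
    (hφ : LocInt (letters γ ω)) {ρ : ℕ → ℂ → ℂ} (hρ : IsBasicSection ω p ρ) (m : ℕ) :
    Tendsto (fun a => iter (letters γ ω) m a b) (𝓝[>] 0) (𝓝 (ρ m (γ b))) := by
  have hsec : IsSection ω ρ (Metric.ball p 1 \ {p}) := hρ.isSection sdiff_subset (by simp)
  -- Transport of the basic section from `a` to `b`: the term with initial value `1` is the wanted
  -- integral, and every other initial value vanishes at `p`, hence contains the factor `γ a - p`.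
  have key : ∀ᶠ a in 𝓝[>] (0 : ℝ), ρ m (γ b) - ∑ k ∈ Finset.range m, (γ a - p) *
      (dslope (ρ (k + 1)) p (γ a) * iter (letters γ fun i => ω (i + (k + 1))) (m - (k + 1)) a b) =
      iter (letters γ ω) m a b := by
    filter_upwards [h.eventually_mem] with a ha
    have hrow := hsec.isRow h.reg hφ (h.Ioc_subset ha) h.time (fun t ht => by
      rw [uIcc_of_le ha.2] at ht
      have ht' : t ∈ Ioc 0 b := ⟨ha.1.trans_le ht.1, ht.2⟩
      exact ⟨h.mem t ht', h.ne (h.Ioc_subset ht')⟩)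
    have h1 := hrow.eq_sum (fun k => hφ k a (h.Ioc_subset ha) b h.time) m b right_mem_uIcc
    rw [Finset.sum_range_succ', hρ.zero, one_mul] at h1
    rw [h1]
    change _ + iter (letters γ ω) m a b - _ = _
    rw [add_sub_right_comm, ← Finset.sum_sub_distrib, Finset.sum_eq_zero, zero_add]
    intro k _
    have h2 := sub_smul_dslope (ρ (k + 1)) p (γ a)
    rw [hρ.center, sub_zero, smul_eq_mul] at h2
    rw [← mul_assoc, h2]
    exact sub_self _
  refine Tendsto.congr' key ?_
  have h3 : Tendsto (fun a => ∑ k ∈ Finset.range m, (γ a - p) *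
      (dslope (ρ (k + 1)) p (γ a) * iter (letters γ fun i => ω (i + (k + 1))) (m - (k + 1)) a b))
      (𝓝[>] 0) (𝓝 (∑ k ∈ Finset.range m, 0)) := by
    refine tendsto_finsetSum _ fun k _ => h.tendsto_mul_tempered (Tempered.mul ?_
      (h.tempered_iter _ (hω.shift (k + 1)) (hφ.shift (k + 1))))
    exact h.tempered_comp ((differentiableOn_dslope_ball (hρ.diff (k + 1))).continuousOn.continuousAt
      (Metric.ball_mem_nhds p one_pos))
  simpa using tendsto_const_nhds.sub h3

/-! ### Continuation of horizontal sections and homotopy invariance -/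

theorem eq_of_hasDerivAt_zero {F : ℂ → ℂ} {W : Set ℂ} (hW : IsOpen W) (hc : Convex ℝ W)
    (hF : ∀ z ∈ W, HasDerivAt F 0 z) {z w : ℂ} (hz : z ∈ W) (hw : w ∈ W) : F z = F w :=
  hW.is_const_of_deriv_eq_zero hc.isPreconnected
    (fun z hz => (hF z hz).differentiableAt.differentiableWithinAt)
    (fun z hz => (hF z hz).deriv) hz hw

/-- Two sections that agree at one point of the intersection of their convex domains agree there. -/
theorem IsSection.eq_of_eq {ω σ σ' : ℕ → ℂ → ℂ} {A B : Set ℂ} (hσ : IsSection ω σ A)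
    (hσ' : IsSection ω σ' B) (hA : IsOpen A) (hAc : Convex ℝ A) (hB : IsOpen B) (hBc : Convex ℝ B)
    {w z : ℂ} (hw : w ∈ A ∩ B) (hz : z ∈ A ∩ B) (h : ∀ k, σ k w = σ' k w) (k : ℕ) :
    σ k z = σ' k z := by
  suffices ∀ z ∈ A ∩ B, σ k z = σ' k z from this z hz
  induction k with
  | zero =>
    intro z hz
    obtain ⟨c, hc⟩ := hσ.1
    obtain ⟨c', hc'⟩ := hσ'.1
    rw [hc z hz.1, hc' z hz.2, ← hc w hw.1, ← hc' w hw.2, h 0]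
  | succ k ih =>
    intro z hz
    have := eq_of_hasDerivAt_zero (F := fun z => σ (k + 1) z - σ' (k + 1) z) (hA.inter hB)
      (hAc.inter hBc) (fun z hz => ((hσ.2 k z hz.1).sub (hσ'.2 k z hz.2)).congr_deriv
        (by rw [ih z hz, sub_self])) hz hw
    simp only [h (k + 1), sub_self] at this
    exact sub_eq_zero.1 this

theorem exists_isSection {ω : ℕ → ℂ → ℂ} {z : ℂ} {δ : ℝ}
    (hω : ∀ k, DifferentiableOn ℂ (ω k) (Metric.ball z δ)) (v : ℕ → ℂ) :
    ∃ σ, IsSection ω σ (Metric.ball z δ) ∧ ∀ k, σ k z = v k := by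
  have hstep : ∀ (k : ℕ) (f : {f : ℂ → ℂ // DifferentiableOn ℂ f (Metric.ball z δ)}),
      ∃ F : {f : ℂ → ℂ // DifferentiableOn ℂ f (Metric.ball z δ)}, F.1 z = v (k + 1) ∧
        ∀ w ∈ Metric.ball z δ, HasDerivAt F.1 (f.1 w * ω k w) w := by
    rintro k ⟨f, hf⟩
    obtain ⟨F, hF0, hF⟩ := exists_primitive (hf.mul (hω k)) (v (k + 1))
    exact ⟨⟨F, differentiableOn_of_hasDerivAt hF⟩, hF0, hF⟩
  choose next hnext0 hnext using hstep
  let σ : ℕ → {f : ℂ → ℂ // DifferentiableOn ℂ f (Metric.ball z δ)} := fun k =>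
    Nat.rec ⟨fun _ => v 0, differentiableOn_const _⟩ next k
  refine ⟨fun k => (σ k).1, ⟨⟨v 0, fun _ _ => rfl⟩, fun k => hnext k (σ k)⟩, fun k => ?_⟩
  cases k with
  | zero => rfl
  | succ k => exact hnext0 k (σ k)

/-- `κ` is a horizontal section of the dual connection for the first `n` forms. -/
def IsCosection (n : ℕ) (ω κ : ℕ → ℂ → ℂ) (W : Set ℂ) : Prop :=
  (∀ k ≤ n, ∀ z ∈ W, HasDerivAt (κ k) (-(ω k z * κ (k + 1) z)) z) ∧ ∀ z, κ (n + 1) z = 0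

/-- The pairing of a section and a cosection is constant. -/
theorem IsSection.pairing_eq {n : ℕ} {ω σ κ : ℕ → ℂ → ℂ} {A B : Set ℂ} (hσ : IsSection ω σ A)
    (hκ : IsCosection n ω κ B) (hA : IsOpen A) (hAc : Convex ℝ A) (hB : IsOpen B)
    (hBc : Convex ℝ B) {w z : ℂ} (hw : w ∈ A ∩ B) (hz : z ∈ A ∩ B) :
    ∑ k ∈ Finset.range (n + 1), σ k w * κ k w = ∑ k ∈ Finset.range (n + 1), σ k z * κ k z := by
  -- The derivatives of the partial sums telescope to one boundary term, which vanishes for `j = n`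
  -- because `κ (n + 1) = 0`.
  have hd : ∀ u ∈ A ∩ B, ∀ j ≤ n, HasDerivAt (fun u => ∑ k ∈ Finset.range (j + 1), σ k u * κ k u)
      (-(σ j u * (ω j u * κ (j + 1) u))) u := by
    intro u hu j
    induction j with
    | zero =>
      intro hj
      obtain ⟨c, hc⟩ := hσ.1
      have h0 : HasDerivAt (σ 0) 0 u := (hasDerivAt_const u c).congr_of_eventuallyEq
        (eventually_of_mem (hA.mem_nhds hu.1) hc)
      simp only [zero_add, Finset.sum_range_one]
      exact (h0.mul (hκ.1 0 hj u hu.2)).congr_deriv (by simp)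
    | succ j ih =>
      intro hj
      simp only [Finset.sum_range_succ _ (j + 1)]
      exact ((ih (by omega)).add ((hσ.2 j u hu.1).mul (hκ.1 (j + 1) hj u hu.2))).congr_deriv
        (by ring)
  exact eq_of_hasDerivAt_zero (F := fun u => ∑ k ∈ Finset.range (n + 1), σ k u * κ k u)
    (hA.inter hB) (hAc.inter hBc) (fun u hu => (hd u hu n le_rfl).congr_deriv (by simp [hκ.2])) hw hz

theorem IsRow.continuousOn {φ R : ℕ → ℝ → ℂ} {a b : ℝ} (hR : IsRow φ R a b)
    (hφ : ∀ k, IntervalIntegrable (φ k) volume a b) (k : ℕ) : ContinuousOn (R k) (uIcc a b) := by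
  induction k with
  | zero => exact continuousOn_const.congr hR.1
  | succ k ih =>
    exact (continuousOn_const.add (intervalIntegral.continuousOn_primitive_interval'
      ((hφ k).continuousOn_mul ih) left_mem_uIcc)).congr (hR.2 k)

theorem IsRow.restrict {φ R : ℕ → ℝ → ℂ} {a b c d : ℝ} (hR : IsRow φ R a b)
    (hφ : ∀ k, IntervalIntegrable (φ k) volume a b) (hc : c ∈ uIcc a b) (hd : d ∈ uIcc a b) :
    IsRow φ R c d := by
  have hsub : uIcc c d ⊆ uIcc a b := uIcc_subset_uIcc hc hd
  refine ⟨fun t ht => (hR.1 t (hsub ht)).trans (hR.1 c hc).symm, fun k t ht => ?_⟩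
  have hi := (hφ k).continuousOn_mul (hR.continuousOn hφ k)
  rw [hR.2 k t (hsub ht), hR.2 k c hc, add_assoc, intervalIntegral.integral_add_adjacent_intervals]
  · exact hi.mono_set (uIcc_subset_uIcc_left hc)
  · exact hi.mono_set (uIcc_subset_uIcc hc (hsub ht))

theorem IsRow.eq_of_eq {φ R R' : ℕ → ℝ → ℂ} {a b : ℝ} (hR : IsRow φ R a b) (hR' : IsRow φ R' a b)
    (hφ : ∀ k, IntervalIntegrable (φ k) volume a b) (h : ∀ k, R k a = R' k a) (k : ℕ) :
    R k b = R' k b := by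
  rw [hR.eq_sum hφ k b right_mem_uIcc, hR'.eq_sum hφ k b right_mem_uIcc]
  simp only [h]

/-- Along homotopic paths, the continuation of a section that is defined near the initial points
has the same pairing with a cosection that is defined near the terminal points. -/
theorem homotopy_pairing {n : ℕ} {ω ρ κ : ℕ → ℂ → ℂ} {U A B : Set ℂ} (hU : IsOpen U)
    (hω : ∀ k, DifferentiableOn ℂ (ω k) U) (hA : IsOpen A) (hAc : Convex ℝ A) (hB : IsOpen B)
    (hBc : Convex ℝ B) (hρ : IsSection ω ρ (A ∩ U)) (hκ : IsCosection n ω κ (B ∩ U))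
    {H : ℝ × ℝ → ℂ} {t₀ t₁ : ℝ} (h₀ : 0 < t₀) (h₀₁ : t₀ ≤ t₁) (h₁ : t₁ < 1)
    (hH : ContinuousOn H (Icc 0 1 ×ˢ Icc t₀ t₁))
    (hHU : ∀ s ∈ Icc (0 : ℝ) 1, ∀ t ∈ Icc t₀ t₁, H (s, t) ∈ U)
    (hHA : ∀ s ∈ Icc (0 : ℝ) 1, H (s, t₀) ∈ A) (hHB : ∀ s ∈ Icc (0 : ℝ) 1, H (s, t₁) ∈ B) :
    ∃ P : ℝ → ℂ, P 0 = P 1 ∧ ∀ s ∈ Icc (0 : ℝ) 1, ∀ γ : ℝ → ℂ, RegularPath γ →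
      LocInt (letters γ ω) → (∀ t ∈ Icc t₀ t₁, γ t = H (s, t)) → ∀ R : ℕ → ℝ → ℂ,
      IsRow (letters γ ω) R t₀ t₁ → (∀ k, R k t₀ = ρ k (γ t₀)) →
      ∑ k ∈ Finset.range (n + 1), R k t₁ * κ k (γ t₁) = P s := by
  have hK : IsCompact (Icc (0 : ℝ) 1 ×ˢ Icc t₀ t₁) := isCompact_Icc.prod isCompact_Icc
  obtain ⟨δ, hδ, hthick⟩ := (hK.image_of_continuousOn hH).exists_thickening_subset_open hU
    (by rintro _ ⟨⟨s, t⟩, ⟨hs, ht⟩, rfl⟩; exact hHU s hs t ht)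
  have hball : ∀ s ∈ Icc (0 : ℝ) 1, ∀ t ∈ Icc t₀ t₁, Metric.ball (H (s, t)) δ ⊆ U :=
    fun s hs t ht => (Metric.ball_subset_thickening (mem_image_of_mem H (mk_mem_prod hs ht)) δ).trans hthick
  obtain ⟨η, hη, hunif⟩ := Metric.uniformContinuousOn_iff.1
    (hK.uniformContinuousOn_of_continuous hH) δ hδ
  have hclose : ∀ s ∈ Icc (0 : ℝ) 1, ∀ s' ∈ Icc (0 : ℝ) 1, ∀ t ∈ Icc t₀ t₁, ∀ t' ∈ Icc t₀ t₁,
      |s' - s| < η → |t' - t| < η → H (s', t') ∈ Metric.ball (H (s, t)) δ := by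
    intro s hs s' hs' t ht t' ht' h h'
    exact hunif (s', t') ⟨hs', ht'⟩ (s, t) ⟨hs, ht⟩ (max_lt h h')
  obtain ⟨N, hN⟩ := exists_nat_one_div_lt hη
  have hN0 : (0 : ℝ) < N + 1 := by positivity
  let τ : ℕ → ℝ := fun j => t₀ + (t₁ - t₀) * (j / (N + 1))
  have hτ : ∀ j ≤ N + 1, τ j ∈ Icc t₀ t₁ := by
    intro j hj
    have hj' : (j : ℝ) / (N + 1) ≤ 1 := (div_le_one hN0).2 (by exact_mod_cast hj)
    have hj0 : 0 ≤ (j : ℝ) / (N + 1) := by positivity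
    constructor
    · have := mul_nonneg (sub_nonneg.2 h₀₁) hj0
      simp only [τ]; linarith
    · have := mul_le_mul_of_nonneg_left hj' (sub_nonneg.2 h₀₁)
      simp only [τ]; linarith
  have hτ0 : τ 0 = t₀ := by simp [τ]
  have hτN : τ (N + 1) = t₁ := by
    simp only [τ, Nat.cast_add, Nat.cast_one]
    rw [div_self hN0.ne']; ring
  have hτle : ∀ j, τ j ≤ τ (j + 1) := by
    intro j
    have : (j : ℝ) / (N + 1) ≤ ((j + 1 : ℕ) : ℝ) / (N + 1) := by
      push_cast
      gcongr
      linarith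
    have := mul_le_mul_of_nonneg_left this (sub_nonneg.2 h₀₁)
    simp only [τ]; linarith
  have hτsucc : ∀ j, τ (j + 1) - τ j < η := by
    intro j
    have : τ (j + 1) - τ j = (t₁ - t₀) * (1 / (N + 1)) := by
      simp only [τ, Nat.cast_add, Nat.cast_one]; ring
    rw [this]
    refine lt_of_le_of_lt (mul_le_of_le_one_left (by positivity) ?_) hN
    linarith
  have hη0 : |(0 : ℝ)| < η := by simpa using hη
  have hτabs : ∀ j, |τ (j + 1) - τ j| < η := fun j => by
    rw [abs_of_nonneg (sub_nonneg.2 (hτle j))]; exact hτsucc j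
  -- The inclusion is kept as a premise so that the local section is a total function of its centre
  -- and initial values; off `U` it is the junk value `0`.
  choose σ hσ using fun (z : ℂ) (v : ℕ → ℂ) => show ∃ σ : ℕ → ℂ → ℂ, Metric.ball z δ ⊆ U →
      IsSection ω σ (Metric.ball z δ) ∧ ∀ k, σ k z = v k by
    by_cases h : Metric.ball z δ ⊆ U
    · obtain ⟨σ, hσ⟩ := exists_isSection (fun k => (hω k).mono h) v
      exact ⟨σ, fun _ => hσ⟩
    · exact ⟨0, fun h' => absurd h' h⟩
  -- `V j s` holds the values at `H (s, τ j)` of the continuation of `ρ` along a chain of discs. It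
  -- is defined for every `s`, although the intermediate paths are only continuous and iterated
  -- integrals along them make no sense.
  let V : ℕ → ℝ → ℕ → ℂ := fun j => Nat.rec (fun s k => ρ k (H (s, t₀)))
    (fun j V s k => σ (H (s, τ j)) (V s) k (H (s, τ (j + 1)))) j
  have hV0 : ∀ s k, V 0 s k = ρ k (H (s, t₀)) := fun _ _ => rfl
  have hVs : ∀ j s k, V (j + 1) s k = σ (H (s, τ j)) (V j s) k (H (s, τ (j + 1))) :=
    fun _ _ _ => rfl
  have hopen : ∀ z : ℂ, IsOpen (Metric.ball z δ) := fun z => Metric.isOpen_ball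
  have hconv : ∀ z : ℂ, Convex ℝ (Metric.ball z δ) := fun z => convex_ball z δ
  -- For nearby parameters the two disc chains carry the same section germs. Intersections of discs
  -- are convex, so agreement at one point suffices at each step.
  have claim₁ : ∀ s ∈ Icc (0 : ℝ) 1, ∀ s' ∈ Icc (0 : ℝ) 1, |s' - s| < η → ∀ j ≤ N + 1, ∀ k,
      V j s' k = σ (H (s, τ j)) (V j s) k (H (s', τ j)) := by
    intro s hs s' hs' hss j
    induction j with
    | zero =>
      intro hj k
      have hb := hball s hs _ (hτ 0 hj)
      obtain ⟨hsec, hval⟩ := hσ (H (s, τ 0)) (V 0 s) hb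
      have hρ' : IsSection ω ρ (A ∩ Metric.ball (H (s, τ 0)) δ) :=
        hρ.mono (inter_subset_inter_right _ hb)
      have m₁ : H (s, t₀) ∈ Metric.ball (H (s, τ 0)) δ := by
        rw [hτ0]; exact Metric.mem_ball_self hδ
      have m₂ : H (s', t₀) ∈ Metric.ball (H (s, τ 0)) δ := by
        rw [hτ0]
        exact hclose s hs s' hs' t₀ ⟨le_rfl, h₀₁⟩ t₀ ⟨le_rfl, h₀₁⟩ hss (by simpa using hη)
      rw [hV0, show H (s', τ 0) = H (s', t₀) by rw [hτ0]]
      refine hρ'.eq_of_eq hsec (hA.inter (hopen _)) (hAc.inter (hconv _)) (hopen _) (hconv _)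
        (w := H (s, t₀)) ⟨⟨hHA s hs, m₁⟩, m₁⟩ ⟨⟨hHA s' hs', m₂⟩, m₂⟩ (fun k => ?_) k
      have := hval k
      rw [hV0, show H (s, τ 0) = H (s, t₀) by rw [hτ0]] at this
      rw [show H (s, τ 0) = H (s, t₀) by rw [hτ0], this]
    | succ j ih =>
      intro hj k
      have hj' : j ≤ N + 1 := by omega
      have ih' := ih hj'
      have b₁ := hball s hs _ (hτ j hj')
      have b₂ := hball s' hs' _ (hτ j hj')
      have b₃ := hball s hs _ (hτ (j + 1) hj)
      obtain ⟨sec₁, val₁⟩ := hσ (H (s, τ j)) (V j s) b₁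
      obtain ⟨sec₂, val₂⟩ := hσ (H (s', τ j)) (V j s') b₂
      obtain ⟨sec₃, val₃⟩ := hσ (H (s, τ (j + 1))) (V (j + 1) s) b₃
      have hz' := hclose s hs s' hs' _ (hτ j hj') _ (hτ j hj') hss (by simpa using hη)
      have hw := hclose s hs s hs _ (hτ j hj') _ (hτ (j + 1) hj) (by simpa using hη) (hτabs j)
      have hw' := hclose s hs s' hs' _ (hτ j hj') _ (hτ (j + 1) hj) hss (hτabs j)
      have hw₂ := hclose s' hs' s' hs' _ (hτ j hj') _ (hτ (j + 1) hj) (by simpa using hη) (hτabs j)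
      have hw₃ := hclose s hs s' hs' _ (hτ (j + 1) hj) _ (hτ (j + 1) hj) hss (by simpa using hη)
      rw [hVs]
      have e₁ : σ (H (s', τ j)) (V j s') k (H (s', τ (j + 1))) =
          σ (H (s, τ j)) (V j s) k (H (s', τ (j + 1))) :=
        sec₂.eq_of_eq sec₁ (hopen _) (hconv _) (hopen _) (hconv _)
          ⟨Metric.mem_ball_self hδ, hz'⟩ ⟨hw₂, hw'⟩ (fun k => by rw [val₂, ih']) k
      have e₂ : σ (H (s, τ (j + 1))) (V (j + 1) s) k (H (s', τ (j + 1))) =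
          σ (H (s, τ j)) (V j s) k (H (s', τ (j + 1))) :=
        sec₃.eq_of_eq sec₁ (hopen _) (hconv _) (hopen _) (hconv _)
          ⟨Metric.mem_ball_self hδ, hw⟩ ⟨hw₃, hw'⟩ (fun k => by rw [val₃, hVs]) k
      rw [e₁, e₂]
  -- The terminal points move with `s`, so it is the pairing with the cosection, not the continued
  -- section's value, that is locally constant.
  have claim₂ : ∀ s ∈ Icc (0 : ℝ) 1, ∀ s' ∈ Icc (0 : ℝ) 1, |s' - s| < η →
      ∑ k ∈ Finset.range (n + 1), V (N + 1) s k * κ k (H (s, t₁)) =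
        ∑ k ∈ Finset.range (n + 1), V (N + 1) s' k * κ k (H (s', t₁)) := by
    intro s hs s' hs' hss
    have hb := hball s hs _ (hτ (N + 1) le_rfl)
    obtain ⟨hsec, hval⟩ := hσ (H (s, τ (N + 1))) (V (N + 1) s) hb
    have c₁ := claim₁ s hs s' hs' hss (N + 1) le_rfl
    have m' := hclose s hs s' hs' _ (hτ (N + 1) le_rfl) _ (hτ (N + 1) le_rfl) hss
      (by simpa using hη)
    have hκ' : IsCosection n ω κ (B ∩ Metric.ball (H (s, τ (N + 1))) δ) :=
      ⟨fun k hk z hz => hκ.1 k hk z ⟨hz.1, hb hz.2⟩, hκ.2⟩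
    have m : H (s, τ (N + 1)) ∈ Metric.ball (H (s, τ (N + 1))) δ := Metric.mem_ball_self hδ
    have := hsec.pairing_eq hκ' (hopen _) (hconv _) (hB.inter (hopen _)) (hBc.inter (hconv _))
      (w := H (s, τ (N + 1))) (z := H (s', τ (N + 1)))
      ⟨m, by rw [hτN]; exact hHB s hs, m⟩ ⟨m', by rw [hτN]; exact hHB s' hs', m'⟩
    rw [← hτN]
    simp only [c₁]
    rw [← this]
    simp only [hval]
  -- On a regular path, continuation through discs agrees with parallel transport by iterated
  -- integrals.
  have claim₃ : ∀ s ∈ Icc (0 : ℝ) 1, ∀ γ : ℝ → ℂ, RegularPath γ →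
      LocInt (letters γ ω) → (∀ t ∈ Icc t₀ t₁, γ t = H (s, t)) → ∀ R : ℕ → ℝ → ℂ,
      IsRow (letters γ ω) R t₀ t₁ → (∀ k, R k t₀ = ρ k (γ t₀)) → ∀ j ≤ N + 1, ∀ k,
      V j s k = R k (τ j) := by
    intro s hs γ hγ hφ hγH R hR hR0 j
    induction j with
    | zero =>
      intro _ k
      rw [hV0, hτ0, hR0, hγH t₀ ⟨le_rfl, h₀₁⟩]
    | succ j ih =>
      intro hj k
      have hj' : j ≤ N + 1 := by omega
      have ih' := ih hj'
      have hIcc : ∀ t ∈ Icc t₀ t₁, t ∈ Ioo (0 : ℝ) 1 := fun t ht =>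
        ⟨h₀.trans_le ht.1, ht.2.trans_lt h₁⟩
      have ht0 := hIcc t₀ ⟨le_rfl, h₀₁⟩
      have ht1 := hIcc t₁ ⟨h₀₁, le_rfl⟩
      have hja := hIcc _ (hτ j hj')
      have hjb := hIcc _ (hτ (j + 1) hj)
      obtain ⟨hsec, hval⟩ := hσ (H (s, τ j)) (V j s) (hball s hs _ (hτ j hj'))
      have hmaps : MapsTo γ (uIcc (τ j) (τ (j + 1))) (Metric.ball (H (s, τ j)) δ) := by
        intro t ht
        rw [uIcc_of_le (hτle j)] at ht
        have htt : t ∈ Icc t₀ t₁ := ⟨(hτ j hj').1.trans ht.1, ht.2.trans (hτ (j + 1) hj).2⟩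
        rw [hγH t htt]
        refine hclose s hs s hs _ (hτ j hj') _ htt (by simpa using hη) ?_
        rw [abs_of_nonneg (sub_nonneg.2 ht.1)]
        exact (sub_le_sub_right ht.2 _).trans_lt (hτsucc j)
      have r₁ := hsec.isRow hγ hφ hja hjb hmaps
      have r₂ := hR.restrict (fun k => hφ k t₀ ht0 t₁ ht1)
        (by rw [uIcc_of_le h₀₁]; exact hτ j hj') (by rw [uIcc_of_le h₀₁]; exact hτ (j + 1) hj)
      have := r₁.eq_of_eq r₂ (fun k => hφ k _ hja _ hjb)
        (fun k => by rw [hγH _ (hτ j hj'), hval, ih']) k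
      rw [hVs, ← this, hγH _ (hτ (j + 1) hj)]
  refine ⟨fun s => ∑ k ∈ Finset.range (n + 1), V (N + 1) s k * κ k (H (s, t₁)), ?_, ?_⟩
  · have hstep : ∀ i ≤ N + 1, ∑ k ∈ Finset.range (n + 1), V (N + 1) 0 k * κ k (H (0, t₁)) =
        ∑ k ∈ Finset.range (n + 1), V (N + 1) ((i : ℝ) / (N + 1)) k *
          κ k (H ((i : ℝ) / (N + 1), t₁)) := by
      have hmem : ∀ i ≤ N + 1, (i : ℝ) / (N + 1) ∈ Icc (0 : ℝ) 1 := fun i hi =>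
        ⟨by positivity, (div_le_one hN0).2 (by exact_mod_cast hi)⟩
      intro i
      induction i with
      | zero => intro _; simp
      | succ i ih =>
        intro hi
        rw [ih (by omega)]
        refine claim₂ _ (hmem i (by omega)) _ (hmem (i + 1) hi) ?_
        have : ((i + 1 : ℕ) : ℝ) / (N + 1) - (i : ℝ) / (N + 1) = 1 / (N + 1) := by
          push_cast; ring
        rw [this, abs_of_nonneg (by positivity)]
        exact hN
    have := hstep (N + 1) le_rfl
    rwa [Nat.cast_add, Nat.cast_one, div_self hN0.ne'] at this
  · intro s hs γ hγ hφ hγH R hR hR0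
    refine Finset.sum_congr rfl fun k _ => ?_
    rw [claim₃ s hs γ hγ hφ hγH R hR hR0 (N + 1) le_rfl k, hτN, hγH t₁ ⟨h₀₁, le_rfl⟩]

/-! ### Piecewise continuously differentiable paths -/

theorem PiecewiseC1.exists_partition {γ : ℝ → ℂ} (h : PiecewiseC1 γ) :
    ∃ s : Set ℝ, s.Countable ∧ ContinuousOn γ (Icc 0 1) ∧
      (∀ t ∈ Ioo (0 : ℝ) 1 \ s, DifferentiableAt ℝ γ t) ∧
      IntervalIntegrable (deriv γ) volume 0 1 := by
  obtain ⟨m, c, h0, hm, hlt, hC⟩ := h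
  -- The values of `c` past `m` are discarded as well; only countability matters.
  refine ⟨range c, countable_range c, ?_⟩
  have key : ∀ i ≤ m, c 0 ≤ c i ∧ ContinuousOn γ (Icc (c 0) (c i)) ∧
      (∀ t ∈ Ioo (c 0) (c i) \ range c, DifferentiableAt ℝ γ t) ∧
      IntervalIntegrable (deriv γ) volume (c 0) (c i) := by
    intro i
    induction i with
    | zero =>
      intro _
      refine ⟨le_rfl, by simp, fun t ht => absurd ht.1 (by simp), by simp⟩
    | succ i ih =>
      intro hi
      obtain ⟨a1, a2, a3, a4⟩ := ih (by omega)
      have hl := hlt i hi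
      have hCi := hC i hi
      have hd : ∀ t ∈ Ioo (c i) (c (i + 1)), DifferentiableAt ℝ γ t := fun t ht =>
        (hCi.differentiableOn one_ne_zero).differentiableAt (Icc_mem_nhds ht.1 ht.2)
      refine ⟨a1.trans hl.le, ?_, ?_, a4.trans ?_⟩
      · rw [← Icc_union_Icc_eq_Icc a1 hl.le]
        exact a2.union_of_isClosed hCi.continuousOn isClosed_Icc isClosed_Icc
      · intro t ht
        rcases lt_trichotomy t (c i) with h1 | h1 | h1
        · exact a3 t ⟨⟨ht.1.1, h1⟩, ht.2⟩
        · exact absurd ⟨i, h1.symm⟩ ht.2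
        · exact hd t ⟨h1, ht.1.2⟩
      · rw [intervalIntegrable_iff_integrableOn_Ioc_of_le hl.le, integrableOn_Ioc_iff_integrableOn_Ioo]
        have h1 := ((hCi.continuousOn_derivWithin (uniqueDiffOn_Icc hl) le_rfl).integrableOn_Icc
          (μ := volume)).mono_set Ioo_subset_Icc_self
        refine h1.congr_fun (fun t ht => ?_) measurableSet_Ioo
        exact derivWithin_of_mem_nhds (Icc_mem_nhds ht.1 ht.2)
  have := key m le_rfl
  rw [h0, hm] at this
  exact this.2

theorem PiecewiseC1.continuousOn {γ : ℝ → ℂ} (h : PiecewiseC1 γ) : ContinuousOn γ (Icc 0 1) := by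
  obtain ⟨s, -, hc, -⟩ := h.exists_partition
  exact hc

theorem PiecewiseC1.regularPath {γ : ℝ → ℂ} (h : PiecewiseC1 γ) : RegularPath γ := by
  obtain ⟨s, hs, hc, hd, hi⟩ := h.exists_partition
  refine ⟨hc.mono Ioo_subset_Icc_self, ⟨s, hs, hd⟩, fun a ha b hb => hi.mono_set ?_⟩
  rw [uIcc_of_le (zero_le_one' ℝ)]
  exact (uIcc_subset_Ioo ha hb).trans Ioo_subset_Icc_self

theorem one_sub_mem_Ioo {t : ℝ} (ht : t ∈ Ioo (0 : ℝ) 1) : 1 - t ∈ Ioo (0 : ℝ) 1 :=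
  ⟨by linarith [ht.2], by linarith [ht.1]⟩

theorem RegularPath.reverse {γ : ℝ → ℂ} (h : RegularPath γ) : RegularPath fun t => γ (1 - t) := by
  obtain ⟨s, hs, hd⟩ := h.diff
  refine ⟨h.cont.comp (by fun_prop) fun t ht => one_sub_mem_Ioo ht,
    ⟨(fun t => 1 - t) '' s, hs.image _, fun t ht => ?_⟩, fun a ha b hb => ?_⟩
  · have : DifferentiableAt ℝ γ (1 - t) :=
      hd _ ⟨one_sub_mem_Ioo ht.1, fun hts => ht.2 ⟨1 - t, hts, by ring⟩⟩
    exact this.comp t (by fun_prop)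
  · have := ((h.int _ (one_sub_mem_Ioo ha) _ (one_sub_mem_Ioo hb)).comp_sub_left 1).neg
    simp only [sub_sub_cancel] at this
    exact this.congr fun t _ => by simp [deriv_comp_const_sub]

theorem BoundedArg.reverse {γ : ℝ → ℂ} {p : ℂ} (h : BoundedArg γ p) :
    BoundedArg (fun t => γ (1 - t)) p := by
  obtain ⟨θ, hc, ⟨C, hC⟩, he⟩ := h
  exact ⟨fun t => θ (1 - t), hc.comp (by fun_prop) fun t ht => one_sub_mem_Ioo ht,
    ⟨C, fun t ht => hC _ (one_sub_mem_Ioo ht)⟩, fun t ht => he _ (one_sub_mem_Ioo ht)⟩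

theorem BoundedArg.exists_emanatesFrom {γ : ℝ → ℂ} {p : ℂ} (h : BoundedArg γ p)
    (hγ : RegularPath γ) (hlim : Tendsto γ (𝓝[>] 0) (𝓝 p)) (hne : ∀ t ∈ Ioo (0 : ℝ) 1, γ t ≠ p)
    {b : ℝ} (hb : b ∈ Ioo (0 : ℝ) 1) (hmem : ∀ t ∈ Ioc 0 b, γ t ∈ Metric.ball p 1) :
    ∃ ℓ, EmanatesFrom γ p ℓ b := by
  obtain ⟨θ, hc, ⟨C, hC⟩, he⟩ := h
  have hpos : ∀ t ∈ Ioo (0 : ℝ) 1, 0 < ‖γ t - p‖ := fun t ht =>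
    norm_pos_iff.2 (sub_ne_zero.2 (hne t ht))
  refine ⟨fun t => (Real.log ‖γ t - p‖ : ℂ) + θ t * Complex.I, hγ, hb, hmem, hlim, ?_, ?_, C, ?_⟩
  · have h1 : ContinuousOn (fun t => Real.log ‖γ t - p‖) (Ioo 0 1) :=
      (hγ.cont.sub continuousOn_const).norm.log fun t ht => (hpos t ht).ne'
    exact (Complex.continuous_ofReal.comp_continuousOn h1).add
      ((Complex.continuous_ofReal.comp_continuousOn hc).mul continuousOn_const)
  · intro t ht
    rw [Complex.exp_add, ← Complex.ofReal_exp, Real.exp_log (hpos t ht), ← he t ht]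
  · intro t ht
    refine (norm_add_le _ _).trans ?_
    rw [norm_mul, Complex.norm_I, mul_one, Complex.norm_real, Complex.norm_real, Real.norm_eq_abs,
      Real.norm_eq_abs, add_comm]
    exact add_le_add_left (hC t ht) _

theorem tendsto_zero_of_continuousOn {γ : ℝ → ℂ} (h : ContinuousOn γ (Icc 0 1)) :
    Tendsto γ (𝓝[>] 0) (𝓝 (γ 0)) := by
  have h1 := h 0 (left_mem_Icc.2 zero_le_one)
  exact h1.mono_left (nhdsWithin_le_of_mem (Icc_mem_nhdsGT one_pos))

theorem tendsto_one_of_continuousOn {γ : ℝ → ℂ} (h : ContinuousOn γ (Icc 0 1)) :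
    Tendsto (fun t => γ (1 - t)) (𝓝[>] 0) (𝓝 (γ 1)) := by
  have h1 : ContinuousOn (fun t => γ (1 - t)) (Icc 0 1) :=
    h.comp (by fun_prop) fun t ht => ⟨by linarith [ht.2], by linarith [ht.1]⟩
  simpa using tendsto_zero_of_continuousOn h1

/-! ### The half-circle -/

theorem boundedArg_of_polar {γ : ℝ → ℂ} {p : ℂ} {r θ : ℝ → ℝ} (hr : ∀ t ∈ Ioo (0 : ℝ) 1, 0 ≤ r t)
    (hθ : Continuous θ) (h : ∀ t, γ t - p = r t * Complex.exp (θ t * Complex.I)) :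
    BoundedArg γ p := by
  refine ⟨θ, hθ.continuousOn, ?_, fun t ht => ?_⟩
  · obtain ⟨C, hC⟩ := isCompact_Icc.exists_bound_of_continuousOn (hθ.continuousOn (s := Icc 0 1))
    exact ⟨C, fun t ht => hC t (Ioo_subset_Icc_self ht)⟩
  · have : ‖γ t - p‖ = r t := by
      rw [h t, norm_mul, Complex.norm_exp_ofReal_mul_I, mul_one, Complex.norm_real,
        Real.norm_of_nonneg (hr t ht)]
    rw [this, h t]

theorem halfCircle_eq_sq (t : ℝ) :
    halfCircle t = Complex.exp ((Real.pi * t / 2 : ℝ) * Complex.I) ^ 2 := by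
  rw [← Complex.exp_nat_mul, halfCircle]
  congr 1
  push_cast
  ring

theorem half_angle_mem {t : ℝ} (ht : t ∈ Ioo (0 : ℝ) 1) :
    Real.pi * t / 2 ∈ Ioo 0 (Real.pi / 2) :=
  ⟨by have := Real.pi_pos; have := ht.1; positivity, by nlinarith [Real.pi_pos, ht.2]⟩

theorem halfCircle_mem {t : ℝ} (ht : t ∈ Ioo (0 : ℝ) 1) :
    halfCircle t ∈ ({0, 1, -1} : Set ℂ)ᶜ := by
  have him : (halfCircle t).im = Real.sin (Real.pi * t) := by
    rw [halfCircle, ← Complex.ofReal_mul, Complex.exp_ofReal_mul_I_im]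
  have hpos : 0 < (halfCircle t).im := by
    rw [him]
    exact Real.sin_pos_of_pos_of_lt_pi (mul_pos Real.pi_pos ht.1)
      (mul_lt_of_lt_one_right Real.pi_pos ht.2)
  simp only [mem_compl_iff, mem_insert_iff, mem_singleton_iff, not_or]
  refine ⟨?_, ?_, ?_⟩ <;> intro h <;> simp [h] at hpos

theorem contDiff_halfCircle : ContDiff ℝ 1 halfCircle := by
  unfold halfCircle
  exact ((contDiff_const.mul Complex.ofRealCLM.contDiff).mul contDiff_const).cexp

/-- The polar forms of the half-circle seen from its endpoints; they give both bounded arguments and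
the square roots in the densities. -/
theorem exp_half_mul (x : ℝ) :
    Complex.exp (x * Complex.I) ^ 2 - 1 = 2 * Complex.sin x * Complex.I * Complex.exp (x * Complex.I) ∧
      Complex.exp (x * Complex.I) ^ 2 + 1 = 2 * Complex.cos x * Complex.exp (x * Complex.I) := by
  have h : Complex.exp (-x * Complex.I) * Complex.exp (x * Complex.I) = 1 := by
    rw [← Complex.exp_add]; simp
  constructor
  · rw [Complex.sin]
    linear_combination h - (Complex.exp (-x * Complex.I) * Complex.exp (x * Complex.I) -
      Complex.exp (x * Complex.I) ^ 2) * Complex.I_sq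
  · rw [Complex.cos]
    linear_combination -h

theorem isHalfTurn_halfCircle : IsHalfTurn halfCircle := by
  have hc : Continuous fun t : ℝ => Real.pi * t / 2 := by fun_prop
  refine ⟨by simp [halfCircle], by simp [halfCircle], fun t ht => halfCircle_mem ht, ?_, ?_, ?_, ?_⟩
  · exact ⟨1, fun i => i, by simp, by simp, fun i _ => by simp,
      fun i _ => contDiff_halfCircle.contDiffOn⟩
  · refine boundedArg_of_polar (r := fun t => 2 * Real.sin (Real.pi * t / 2))
      (θ := fun t => Real.pi / 2 + Real.pi * t / 2) (fun t ht => ?_)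
      (continuous_const.add hc) fun t => ?_
    · have := half_angle_mem ht
      have := Real.sin_pos_of_pos_of_lt_pi this.1 (by linarith [this.2, Real.pi_pos])
      positivity
    · rw [halfCircle_eq_sq, (exp_half_mul _).1, Complex.ofReal_add (Real.pi / 2), add_mul,
        Complex.exp_add]
      push_cast
      rw [Complex.exp_pi_div_two_mul_I]
      ring
  · refine boundedArg_of_polar (r := fun t => 2 * Real.cos (Real.pi * t / 2))
      (θ := fun t => Real.pi * t / 2) (fun t ht => ?_) hc fun t => ?_
    · have := half_angle_mem ht
      have := Real.cos_pos_of_mem_Ioo ⟨by linarith [this.1, Real.pi_pos], this.2⟩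
      positivity
    · rw [halfCircle_eq_sq, sub_neg_eq_add, (exp_half_mul _).2]
      push_cast
      ring
  · exact ⟨fun q => halfCircle q.2, (contDiff_halfCircle.continuous.comp continuous_snd).continuousOn,
      fun _ _ => ⟨rfl, rfl⟩, fun _ _ => ⟨rfl, rfl, fun t ht => halfCircle_mem ht⟩⟩

/-! ### Iterated integrals along half-turns -/

theorem iter_self (φ : ℕ → ℝ → ℂ) (m : ℕ) (a : ℝ) : iter φ (m + 1) a a = 0 := by
  simp [iter]

/-- The horizontal section along a path with given initial values. -/
theorem isRow_sum {φ : ℕ → ℝ → ℂ} {a b : ℝ} (hφ : ∀ k, IntervalIntegrable (φ k) volume a b)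
    (v : ℕ → ℂ) :
    IsRow φ (fun m t => ∑ j ∈ Finset.range (m + 1), v j * iter (shift j φ) (m - j) a t) a b ∧
      ∀ m, ∑ j ∈ Finset.range (m + 1), v j * iter (shift j φ) (m - j) a a = v m := by
  have hinit : ∀ m, ∑ j ∈ Finset.range (m + 1), v j * iter (shift j φ) (m - j) a a = v m := by
    intro m
    rw [Finset.sum_range_succ, Finset.sum_eq_zero]
    · simp [iter]
    · intro j hj
      have : m - j = (m - j - 1) + 1 := by have := Finset.mem_range.1 hj; omega
      rw [this, iter_self, mul_zero]
  refine ⟨⟨fun t _ => by simp [iter], fun m t ht => ?_⟩, hinit⟩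
  have hsub : uIcc a t ⊆ uIcc a b := uIcc_subset_uIcc_left ht
  simp only
  rw [hinit (m + 1), Finset.sum_range_succ _ (m + 1), add_comm]
  congr 1
  · simp [iter]
  · simp only [Finset.sum_mul]
    rw [intervalIntegral.integral_finsetSum]
    · refine Finset.sum_congr rfl fun j hj => ?_
      have h1 : m + 1 - j = (m - j) + 1 := Nat.succ_sub (Finset.mem_range_succ_iff.1 hj)
      have h2 : m - j + j = m := Nat.sub_add_cancel (Finset.mem_range_succ_iff.1 hj)
      rw [h1, iter, ← intervalIntegral.integral_const_mul]
      simp only [shift, h2, mul_assoc]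
    · intro j hj
      have h2 : m - j + j = m := Nat.sub_add_cancel (Finset.mem_range_succ_iff.1 hj)
      have := (intervalIntegrable_iter_mul (φ := shift j φ)
        (fun i => (hφ (i + j)).mono_set hsub) (m - j)).const_mul (v j)
      simpa only [shift, h2, mul_assoc] using this

theorem IsHalfTurn.maps {γ : ℝ → ℂ} (hγ : IsHalfTurn γ) :
    MapsTo γ (Ioo 0 1) ({0, 1, -1} : Set ℂ)ᶜ := hγ.mem

/-- The value of the iterated integrals along a half-turn in terms of sections near the endpoints. -/
theorem IsHalfTurn.tendsto_iter {γ : ℝ → ℂ} (hγ : IsHalfTurn γ) {n : ℕ}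
    {ω : ℕ → ℂ → ℂ} (hω : ∀ k, ContinuousOn (ω k) ({0, 1, -1} : Set ℂ)ᶜ)
    {c c' : ℕ → ℂ} {g g' : ℕ → ℂ → ℂ} (hp : SimplePoles ω 1 c g)
    (hp' : SimplePoles (fun i z => -ω (n - 1 - i) z) (-1) c' g')
    {ρ ρ' : ℕ → ℂ → ℂ} (hρ : IsBasicSection ω 1 ρ)
    (hρ' : IsBasicSection (fun i z => -ω (n - 1 - i) z) (-1) ρ') {t₀ t₁ : ℝ}
    (h₀ : t₀ ∈ Ioo (0 : ℝ) 1) (h₁ : t₁ ∈ Ioo (0 : ℝ) 1)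
    (hb₀ : ∀ t ∈ Ioc 0 t₀, γ t ∈ Metric.ball 1 1)
    (hb₁ : ∀ t ∈ Ico t₁ 1, γ t ∈ Metric.ball (-1) 1) :
    Tendsto (fun q : ℝ × ℝ => iter (letters γ ω) n q.1 q.2) (𝓝[>] (0 : ℝ) ×ˢ 𝓝[<] (1 : ℝ))
      (𝓝 (∑ k ∈ Finset.range (n + 1), (∑ j ∈ Finset.range (k + 1),
        ρ j (γ t₀) * iter (shift j (letters γ ω)) (k - j) t₀ t₁) * ρ' (n - k) (γ t₁))) := by
  have hreg := hγ.piecewise.regularPath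
  have hcont := hγ.piecewise.continuousOn
  have hφ : LocInt (letters γ ω) := hreg.locInt hγ.maps hω
  have hφ' : LocInt (letters (fun t => γ (1 - t)) fun i z => -ω (n - 1 - i) z) :=
    hreg.reverse.locInt (fun t ht => hγ.maps (one_sub_mem_Ioo ht)) fun k => (hω _).neg
  have hne : ∀ t ∈ Ioo (0 : ℝ) 1, γ t ≠ 1 := fun t ht h => hγ.mem t ht (by simp [h])
  have hne' : ∀ t ∈ Ioo (0 : ℝ) 1, γ (1 - t) ≠ -1 := fun t ht h =>
    hγ.mem _ (one_sub_mem_Ioo ht) (by simp [h])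
  obtain ⟨ℓ, hℓ⟩ := hγ.arg_source.exists_emanatesFrom hreg
    (hγ.source ▸ tendsto_zero_of_continuousOn hcont) hne h₀ hb₀
  obtain ⟨ℓ', hℓ'⟩ := hγ.arg_target.reverse.exists_emanatesFrom hreg.reverse
    (hγ.target ▸ tendsto_one_of_continuousOn hcont) hne' (one_sub_mem_Ioo h₁)
    (fun t ht => hb₁ _ ⟨by linarith [ht.2], by linarith [ht.1]⟩)
  have hleft : ∀ k, Tendsto (fun a => iter (letters γ ω) k a t₁) (𝓝[>] 0)
      (𝓝 (∑ j ∈ Finset.range (k + 1), ρ j (γ t₀) *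
        iter (shift j (letters γ ω)) (k - j) t₀ t₁)) := by
    intro k
    have h1 : Tendsto (fun a => ∑ j ∈ Finset.range (k + 1), iter (letters γ ω) j a t₀ *
        iter (shift j (letters γ ω)) (k - j) t₀ t₁) (𝓝[>] 0)
        (𝓝 (∑ j ∈ Finset.range (k + 1), ρ j (γ t₀) *
          iter (shift j (letters γ ω)) (k - j) t₀ t₁)) :=
      tendsto_finsetSum _ fun j _ => (hℓ.tendsto_iter hp hφ hρ j).mul_const _
    refine h1.congr' ?_
    filter_upwards [hℓ.eventually_mem] with a ha
    exact (iter_comp hφ (hℓ.Ioc_subset ha) h₀ h₁ k).symm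
  have hright : ∀ k ≤ n, Tendsto (fun b => iter (shift k (letters γ ω)) (n - k) t₁ b) (𝓝[<] 1)
      (𝓝 (ρ' (n - k) (γ t₁))) := by
    intro k hk
    have h1 := hℓ'.tendsto_iter hp' hφ' hρ' (n - k)
    simp only [sub_sub_cancel] at h1
    have h2 : Tendsto (fun b : ℝ => 1 - b) (𝓝[<] 1) (𝓝[>] 0) := by
      refine tendsto_nhdsWithin_iff.2 ⟨?_, ?_⟩
      · have : Tendsto (fun b : ℝ => 1 - b) (𝓝 1) (𝓝 (1 - 1)) :=
          (continuous_const.sub continuous_id).tendsto 1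
        rw [sub_self] at this
        exact this.mono_left nhdsWithin_le_nhds
      · filter_upwards [self_mem_nhdsWithin] with b hb
        exact sub_pos.2 (mem_Iio.1 hb)
    refine (h1.comp h2).congr' ?_
    filter_upwards [Ioo_mem_nhdsLT h₁.2] with b hb
    have hb' : b ∈ Ioo (0 : ℝ) 1 := ⟨h₁.1.trans hb.1, hb.2⟩
    symm
    refine iter_reverse hb.1.le
      (fun i => ((hφ.shift k i t₁ h₁ b hb').1).mono_set Ioo_subset_Ioc_self)
      (fun i => ((hφ' i _ (one_sub_mem_Ioo hb') _ (one_sub_mem_Ioo h₁)).1).mono_set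
        Ioo_subset_Ioc_self) fun i hi t => ?_
    -- Reversal turns the order of the word around. The sign in `-ω` cancels the one from
    -- differentiating `γ (1 - t)`.
    have : n - k - 1 - i + k = n - 1 - i := by omega
    simp only [shift, letters, this, deriv_comp_const_sub]
    ring
  have hsum : Tendsto (fun q : ℝ × ℝ => ∑ k ∈ Finset.range (n + 1),
      iter (letters γ ω) k q.1 t₁ * iter (shift k (letters γ ω)) (n - k) t₁ q.2)
      (𝓝[>] (0 : ℝ) ×ˢ 𝓝[<] (1 : ℝ))
      (𝓝 (∑ k ∈ Finset.range (n + 1), (∑ j ∈ Finset.range (k + 1),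
        ρ j (γ t₀) * iter (shift j (letters γ ω)) (k - j) t₀ t₁) * ρ' (n - k) (γ t₁))) :=
    tendsto_finsetSum _ fun k hk => ((hleft k).comp tendsto_fst).mul
      ((hright k (Finset.mem_range_succ_iff.1 hk)).comp tendsto_snd)
  refine hsum.congr' ?_
  have ha : ∀ᶠ a in 𝓝[>] (0 : ℝ), a ∈ Ioo (0 : ℝ) 1 := Ioo_mem_nhdsGT one_pos
  have hb : ∀ᶠ b in 𝓝[<] (1 : ℝ), b ∈ Ioo (0 : ℝ) 1 := Ioo_mem_nhdsLT one_pos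
  filter_upwards [ha.prod_mk hb] with q hq
  exact (iter_comp hφ hq.1 h₁ hq.2 n).symm

/-- Reversing the word dualizes the connection: the section trivial at the terminal point, read
backwards, is a cosection. Indices past `n` are cut off to make the last equation homogeneous. -/
theorem isCosection_of_isBasicSection {n : ℕ} {ω ρ : ℕ → ℂ → ℂ} {p : ℂ} {W : Set ℂ}
    (hρ : IsBasicSection (fun i z => -ω (n - 1 - i) z) p ρ) (hW : W ⊆ Metric.ball p 1) (hp : p ∉ W) :
    IsCosection n ω (fun k z => if k ≤ n then ρ (n - k) z else 0) W := by
  refine ⟨fun k hk z hz => ?_, fun z => by simp⟩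
  simp only [hk, if_true]
  rcases hk.lt_or_eq with h | rfl
  · have h1 : n - k = (n - (k + 1)) + 1 := by omega
    have h2 : n - 1 - (n - (k + 1)) = k := by omega
    have := hρ.deriv (n - (k + 1)) z (hW hz) fun e => hp (e ▸ hz)
    rw [← h1, h2] at this
    refine this.congr_deriv ?_
    rw [if_pos (Nat.succ_le_of_lt h)]
    ring
  · have : ρ (k - k) = fun _ => 1 := by
      rw [Nat.sub_self]; exact funext hρ.zero
    rw [this]
    simpa using hasDerivAt_const z (1 : ℂ)

/-- The iterated integrals along half-turns converge and do not depend on the half-turn. -/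
theorem exists_tendsto_iter (n : ℕ) {ω : ℕ → ℂ → ℂ}
    (hω : ∀ k, DifferentiableOn ℂ (ω k) ({0, 1, -1} : Set ℂ)ᶜ) {c c' : ℕ → ℂ} {g g' : ℕ → ℂ → ℂ}
    (hp : SimplePoles ω 1 c g) (hp' : SimplePoles (fun i z => -ω (n - 1 - i) z) (-1) c' g')
    (hc : c 0 = 0) (hc' : c' 0 = 0) :
    ∃ L, ∀ γ, IsHalfTurn γ → Tendsto (fun q : ℝ × ℝ => iter (letters γ ω) n q.1 q.2)
      (𝓝[>] (0 : ℝ) ×ˢ 𝓝[<] (1 : ℝ)) (𝓝 L) := by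
  obtain ⟨ρ, hρ⟩ := exists_isBasicSection hp hc
  obtain ⟨ρ', hρ'⟩ := exists_isBasicSection hp' hc'
  -- The homotopy and the grid depend on `γ`, so each `γ` is compared separately with the
  -- half-circle, whose limit is unique.
  suffices ∀ γ, IsHalfTurn γ → ∃ L, Tendsto (fun q : ℝ × ℝ => iter (letters halfCircle ω) n q.1 q.2)
      (𝓝[>] (0 : ℝ) ×ˢ 𝓝[<] (1 : ℝ)) (𝓝 L) ∧
      Tendsto (fun q : ℝ × ℝ => iter (letters γ ω) n q.1 q.2)
      (𝓝[>] (0 : ℝ) ×ˢ 𝓝[<] (1 : ℝ)) (𝓝 L) by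
    obtain ⟨L, hL, -⟩ := this _ isHalfTurn_halfCircle
    refine ⟨L, fun γ hγ => ?_⟩
    obtain ⟨L', h1, h2⟩ := this γ hγ
    rwa [tendsto_nhds_unique hL h1]
  intro γ hγ
  obtain ⟨H, hH, hH01, hHs⟩ := hγ.halfTurn
  have hhc := isHalfTurn_halfCircle
  obtain ⟨η, hη, hunif⟩ := Metric.uniformContinuousOn_iff.1
    ((isCompact_Icc.prod isCompact_Icc).uniformContinuousOn_of_continuous hH) 1 one_pos
  -- `t₀ < η` keeps the initial and final arcs of all paths of the homotopy in the unit discs around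
  -- `1` and `-1`; the bound `1 / 3` ensures `t₀ ≤ 1 - t₀`.
  set t₀ : ℝ := min (η / 2) (1 / 3) with ht₀
  have h₀ : t₀ ∈ Ioo (0 : ℝ) (1 / 2) :=
    ⟨lt_min (by positivity) (by norm_num), (min_le_right _ _).trans_lt (by norm_num)⟩
  have h₀η : t₀ < η := (min_le_left _ _).trans_lt (by linarith)
  have h₀I : t₀ ∈ Ioo (0 : ℝ) 1 := ⟨h₀.1, h₀.2.trans (by norm_num)⟩
  have h₁I := one_sub_mem_Ioo h₀I
  have hle : t₀ ≤ 1 - t₀ := by linarith [h₀.2]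
  have hb₀ : ∀ s ∈ Icc (0 : ℝ) 1, ∀ t ∈ Ioc 0 t₀, H (s, t) ∈ Metric.ball 1 1 := by
    intro s hs t ht
    have h1 := hunif (s, t) ⟨hs, ht.1.le, ht.2.trans h₀I.2.le⟩ (s, 0) ⟨hs, le_rfl, zero_le_one⟩
      (by rw [Prod.dist_eq]
          refine max_lt (by simpa using hη) ?_
          rw [Real.dist_eq, sub_zero, abs_of_pos ht.1]
          exact ht.2.trans_lt h₀η)
    rwa [(hHs s hs).1, hhc.source] at h1
  have hb₁ : ∀ s ∈ Icc (0 : ℝ) 1, ∀ t ∈ Ico (1 - t₀) 1, H (s, t) ∈ Metric.ball (-1) 1 := by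
    intro s hs t ht
    have h1 := hunif (s, t) ⟨hs, h₁I.1.le.trans ht.1, ht.2.le⟩ (s, 1) ⟨hs, zero_le_one, le_rfl⟩
      (by rw [Prod.dist_eq]
          refine max_lt (by simpa using hη) ?_
          rw [Real.dist_eq, abs_sub_comm, abs_of_pos (sub_pos.2 ht.2)]
          linarith [ht.1])
    rwa [(hHs s hs).2.1, hhc.target] at h1
  have z0 : (0 : ℝ) ∈ Icc (0 : ℝ) 1 := ⟨le_rfl, zero_le_one⟩
  have z1 : (1 : ℝ) ∈ Icc (0 : ℝ) 1 := ⟨zero_le_one, le_rfl⟩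
  have hIcc : ∀ t ∈ Icc t₀ (1 - t₀), t ∈ Ioo (0 : ℝ) 1 := fun t ht =>
    ⟨h₀.1.trans_le ht.1, ht.2.trans_lt h₁I.2⟩
  have hU : IsOpen ({0, 1, -1} : Set ℂ)ᶜ := (Set.toFinite _).isClosed.isOpen_compl
  -- A punctured disc is not simply connected, yet `ρ` is single-valued on it, because it extends
  -- holomorphically to the centre.
  have hsec : IsSection ω ρ (Metric.ball 1 1 ∩ ({0, 1, -1} : Set ℂ)ᶜ) :=
    hρ.isSection inter_subset_left (by simp)
  have hcosec := isCosection_of_isBasicSection (W := Metric.ball (-1) 1 ∩ ({0, 1, -1} : Set ℂ)ᶜ)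
    hρ' inter_subset_left (by simp)
  obtain ⟨P, hP01, hP⟩ := homotopy_pairing hU hω Metric.isOpen_ball (convex_ball _ _)
    Metric.isOpen_ball (convex_ball _ _) hsec hcosec h₀.1 hle h₁I.2
    (hH.mono (prod_mono_right fun t ht => Ioo_subset_Icc_self (hIcc t ht)))
    (fun s hs t ht => (hHs s hs).2.2 t (hIcc t ht))
    (fun s hs => hb₀ s hs t₀ ⟨h₀.1, le_rfl⟩) (fun s hs => hb₁ s hs _ ⟨le_rfl, h₁I.2⟩)
  have key : ∀ s ∈ Icc (0 : ℝ) 1, ∀ γ, IsHalfTurn γ → (∀ t ∈ Icc (0 : ℝ) 1, γ t = H (s, t)) →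
      Tendsto (fun q : ℝ × ℝ => iter (letters γ ω) n q.1 q.2)
        (𝓝[>] (0 : ℝ) ×ˢ 𝓝[<] (1 : ℝ)) (𝓝 (P s)) := by
    intro s hs γ hγ hγH
    have hφ : LocInt (letters γ ω) :=
      hγ.piecewise.regularPath.locInt hγ.maps fun k => (hω k).continuousOn
    have h1 := hγ.tendsto_iter (fun k => (hω k).continuousOn) hp hp' hρ hρ' h₀I h₁I
      (fun t ht => by
        rw [hγH t ⟨ht.1.le, ht.2.trans h₀I.2.le⟩]; exact hb₀ s hs t ht)
      (fun t ht => by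
        rw [hγH t ⟨h₁I.1.le.trans ht.1, ht.2.le⟩]; exact hb₁ s hs t ht)
    obtain ⟨hrow, hinit⟩ := isRow_sum (fun k => hφ k t₀ h₀I (1 - t₀) h₁I) fun j => ρ j (γ t₀)
    rw [← hP s hs γ hγ.piecewise.regularPath hφ
      (fun t ht => hγH t (Ioo_subset_Icc_self (hIcc t ht))) _ hrow hinit]
    convert h1 using 2
    refine Finset.sum_congr rfl fun k hk => ?_
    rw [if_pos (Finset.mem_range_succ_iff.1 hk)]
  refine ⟨P 0, key 0 z0 _ hhc fun t ht => (hH01 t ht).1.symm, ?_⟩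
  rw [hP01]
  exact key 1 z1 γ hγ fun t ht => (hH01 t ht).2.symm

/-! ### The forms `h` and their restrictions to the half-circle -/

/-- A square root of the sign of a letter. -/
noncomputable def phase (x : ℤˣ) : ℂ := if x = 1 then 1 else Complex.I

/-- The density `q ^ (-1/2)` as a real function. -/
noncomputable def weight (x : ℤˣ) (v : ℝ) : ℝ := (√(q x v))⁻¹

/-- The form `h x y` on the half-circle in the coordinate `v` with `χ = 1 - 2 v`. -/
noncomputable def density (x y : ℤˣ) (v : ℝ) : ℂ :=
  phase x * phase y * ((weight x v * weight y v : ℝ) : ℂ)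

theorem weight_nonneg (x : ℤˣ) (v : ℝ) : 0 ≤ weight x v := inv_nonneg.2 (Real.sqrt_nonneg _)

theorem continuousOn_weight (x : ℤˣ) : ContinuousOn (weight x) (Ioo 0 1) := by
  have hq : Continuous (q x) := by
    unfold q
    split_ifs <;> fun_prop
  exact (Real.continuous_sqrt.comp hq).continuousOn.inv₀ fun v hv =>
    (Real.sqrt_pos.2 (q_pos x hv)).ne'

theorem continuousOn_density (x y : ℤˣ) : ContinuousOn (density x y) (Ioo 0 1) :=
  continuousOn_const.mul (Complex.continuous_ofReal.comp_continuousOn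
    ((continuousOn_weight x).mul (continuousOn_weight y)))

/-- The coordinate `v = (1 - cos (π t)) / 2` of the point `χ (e ^ (π i t))`. -/
noncomputable def coord (t : ℝ) : ℝ := Real.sin (Real.pi * t / 2) ^ 2

noncomputable def coordDeriv (t : ℝ) : ℝ :=
  Real.pi * (Real.sin (Real.pi * t / 2) * Real.cos (Real.pi * t / 2))

theorem hasDerivAt_coord (t : ℝ) : HasDerivAt coord (coordDeriv t) t := by
  have h1 : HasDerivAt (fun t : ℝ => Real.pi * t / 2) (Real.pi / 2) t := by
    simpa using ((hasDerivAt_id t).const_mul Real.pi).div_const 2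
  exact (h1.sin.fun_pow 2).congr_deriv (by simp [coordDeriv]; ring)

theorem sin_cos_half_pos {t : ℝ} (ht : t ∈ Ioo (0 : ℝ) 1) :
    0 < Real.sin (Real.pi * t / 2) ∧ 0 < Real.cos (Real.pi * t / 2) := by
  have := half_angle_mem ht
  exact ⟨Real.sin_pos_of_pos_of_lt_pi this.1 (by linarith [this.2, Real.pi_pos]),
    Real.cos_pos_of_mem_Ioo ⟨by linarith [this.1, Real.pi_pos], this.2⟩⟩

theorem coord_mem {t : ℝ} (ht : t ∈ Ioo (0 : ℝ) 1) : coord t ∈ Ioo (0 : ℝ) 1 := by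
  obtain ⟨h1, h2⟩ := sin_cos_half_pos ht
  refine ⟨by unfold coord; positivity, ?_⟩
  have := Real.sin_sq_add_cos_sq (Real.pi * t / 2)
  unfold coord
  nlinarith [mul_pos h2 h2]

theorem continuous_coord : Continuous coord := by
  unfold coord; fun_prop

theorem tendsto_coord_zero : Tendsto coord (𝓝[>] 0) (𝓝[>] 0) := by
  refine tendsto_nhdsWithin_iff.2 ⟨?_, ?_⟩
  · have := continuous_coord.tendsto 0
    simp only [coord, mul_zero, zero_div, Real.sin_zero, ne_eq, OfNat.ofNat_ne_zero,
      not_false_eq_true, zero_pow] at this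
    exact this.mono_left nhdsWithin_le_nhds
  · filter_upwards [Ioo_mem_nhdsGT one_pos] with t ht using (coord_mem ht).1

theorem tendsto_coord_one : Tendsto coord (𝓝[<] 1) (𝓝[<] 1) := by
  refine tendsto_nhdsWithin_iff.2 ⟨?_, ?_⟩
  · have := continuous_coord.tendsto 1
    simp only [coord, mul_one, Real.sin_pi_div_two, one_pow] at this
    exact this.mono_left nhdsWithin_le_nhds
  · filter_upwards [Ioo_mem_nhdsLT one_pos] with t ht using (coord_mem ht).2

theorem h_eq (x y : ℤˣ) (z : ℂ) :
    h x y z = (if x = y then -1 else 1) * e 0 z + (if x = 1 ∧ y = 1 then 2 else 0) * e 1 z +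
      (if x = -1 ∧ y = -1 then 2 else 0) * e (-1) z := by
  have h1 : (1 : ℤˣ) ≠ -1 := by decide
  rcases Int.units_eq_one_or x with rfl | rfl <;> rcases Int.units_eq_one_or y with rfl | rfl <;>
    simp [h, h1, h1.symm] <;> ring

/-- With `S`, `C` the sine and cosine of the half angle, `q` takes the values `S ^ 2` and `C ^ 2`.
The forms `h x x` multiply to `π i (T + 1) / (T - 1)` or its inverse counterpart `π i (T - 1) / (T +
1)`, that is, `π C / S` or `-π S / C`, whereas `e_0` gives `π i`. -/
theorem h_halfCircle (x y : ℤˣ) {t : ℝ} (ht : t ∈ Ioo (0 : ℝ) 1) :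
    h x y (halfCircle t) * deriv halfCircle t = density x y (coord t) * (coordDeriv t : ℂ) := by
  obtain ⟨hS, hC⟩ := sin_cos_half_pos ht
  have hd : deriv halfCircle t = Real.pi * Complex.I * halfCircle t := by
    have h1 : HasDerivAt (fun t : ℝ => (Real.pi * t * Complex.I : ℂ)) (Real.pi * Complex.I) t := by
      simpa using ((Complex.ofRealCLM.hasDerivAt (x := t)).const_mul (Real.pi : ℂ)).mul_const
        Complex.I
    rw [show halfCircle = fun t : ℝ => Complex.exp (Real.pi * t * Complex.I) from rfl, h1.cexp.deriv]
    ring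
  have hm := halfCircle_mem ht
  simp only [mem_compl_iff, mem_insert_iff, mem_singleton_iff, not_or] at hm
  obtain ⟨hm0, hm1, hm2⟩ := hm
  have e1 : √(Real.sin (Real.pi * t / 2) ^ 2) = Real.sin (Real.pi * t / 2) := Real.sqrt_sq hS.le
  have e2 : √(1 - Real.sin (Real.pi * t / 2) ^ 2) = Real.cos (Real.pi * t / 2) := by
    rw [← Real.cos_sq', Real.sqrt_sq hC.le]
  have m1 : halfCircle t - 1 = _ := (halfCircle_eq_sq t).symm ▸ (exp_half_mul (Real.pi * t / 2)).1
  have m2 : halfCircle t + 1 = _ := (halfCircle_eq_sq t).symm ▸ (exp_half_mul (Real.pi * t / 2)).2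
  have hm1' : halfCircle t - 1 ≠ 0 := sub_ne_zero.2 hm1
  have hm2' : halfCircle t + 1 ≠ 0 := by
    intro h; exact hm2 (eq_neg_of_add_eq_zero_left h)
  have hE : Complex.exp ((Real.pi * t / 2 : ℝ) * Complex.I) ≠ 0 := Complex.exp_ne_zero _
  rw [hd]
  simp only [density, weight, coord, coordDeriv]
  generalize halfCircle t = T at *
  rw [← Complex.ofReal_sin] at m1
  rw [← Complex.ofReal_cos] at m2
  generalize Real.sin (Real.pi * t / 2) = S at *
  generalize Real.cos (Real.pi * t / 2) = C at *
  generalize Complex.exp ((Real.pi * t / 2 : ℝ) * Complex.I) = E at *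
  have hS' : (S : ℂ) ≠ 0 := by exact_mod_cast hS.ne'
  have hC' : (C : ℂ) ≠ 0 := by exact_mod_cast hC.ne'
  have h1 : (1 : ℤˣ) ≠ -1 := by decide
  rcases Int.units_eq_one_or x with rfl | rfl <;> rcases Int.units_eq_one_or y with rfl | rfl <;>
    simp only [h, e, q, phase, if_true, if_false, h1, h1.symm, e1, e2, Units.val_one, Units.val_neg,
      Int.cast_one, Int.cast_neg, sub_neg_eq_add, sub_zero] <;> push_cast
  · have : 2 * (1 / (T - 1)) - 1 / T = (T + 1) / (T * (T - 1)) := by field_simp; ring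
    rw [this, m1, m2]
    field_simp
  · field_simp
  · field_simp
  · have : 2 * (1 / (T + 1)) - 1 / T = (T - 1) / (T * (T + 1)) := by field_simp; ring
    rw [this, m1, m2]
    field_simp

theorem e_dch (x : ℤˣ) {v : ℝ} (hv : v ∈ Ioo (0 : ℝ) 1) :
    e ((x : ℤ) : ℂ) (dch v) * deriv dch v = density x x v := by
  have hd : deriv dch v = -2 := by
    have h1 : HasDerivAt (fun t : ℝ => (1 - 2 * t : ℂ)) (-2) v := by
      simpa using ((Complex.ofRealCLM.hasDerivAt (x := v)).const_mul (2 : ℂ)).const_sub 1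
    exact h1.deriv
  have h1 : (1 : ℤˣ) ≠ -1 := by decide
  have hq := q_pos x hv
  rw [hd, density, weight, ← mul_inv, Real.mul_self_sqrt hq.le]
  have h0 : (v : ℂ) ≠ 0 := by exact_mod_cast hv.1.ne'
  have h2 : (1 - v : ℂ) ≠ 0 := by
    have := (sub_pos.2 hv.2).ne'
    exact_mod_cast this
  rcases Int.units_eq_one_or x with rfl | rfl
  · simp [e, dch, phase, q]
  · simp [e, dch, phase, q, h1.symm]
    have : (1 - 2 * v + 1 : ℂ) = 2 * (1 - v) := by ring
    rw [this]
    field_simp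

/-! ### Pullback along `χ` -/

theorem hasStrictDerivAt_chi {τ : ℂ} (hτ : τ ≠ 0) :
    HasStrictDerivAt chi ((1 - (τ ^ 2)⁻¹) / 2) τ := by
  have := ((hasStrictDerivAt_id τ).add (hasStrictDerivAt_inv hτ)).div_const 2
  exact this.congr_deriv (by ring)

/-- The chain rule holds also at corners, where `deriv` has the default value `0`: away from `±1`
the map `χ` is locally invertible, so a derivative of `χ ∘ γ` would yield one of `γ`. -/
theorem deriv_chi_comp {γ : ℝ → ℂ} {t : ℝ} (hc : ContinuousAt γ t)
    (ht : γ t ∈ ({0, 1, -1} : Set ℂ)ᶜ) :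
    deriv (fun t => chi (γ t)) t = (1 - (γ t ^ 2)⁻¹) / 2 * deriv γ t := by
  simp only [mem_compl_iff, mem_insert_iff, mem_singleton_iff, not_or] at ht
  obtain ⟨h0, h1, h2⟩ := ht
  have hχ := hasStrictDerivAt_chi h0
  have hne : (1 - (γ t ^ 2)⁻¹) / 2 ≠ 0 := by
    intro h
    have h3 : (γ t ^ 2)⁻¹ = 1 := by linear_combination -2 * h
    have h4 : (γ t - 1) * (γ t + 1) = 0 := by linear_combination inv_eq_one.1 h3
    rcases mul_eq_zero.1 h4 with h5 | h5
    · exact h1 (sub_eq_zero.1 h5)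
    · exact h2 (eq_neg_of_add_eq_zero_left h5)
  by_cases hd : DifferentiableAt ℝ γ t
  · exact (hχ.hasDerivAt.comp t hd.hasDerivAt).deriv
  · rw [deriv_zero_of_not_differentiableAt hd, mul_zero]
    refine deriv_zero_of_not_differentiableAt fun hd' => hd ?_
    have hinv := hχ.to_localInverse hne
    have h3 := (hinv.hasDerivAt.comp t (h := fun t => chi (γ t)) hd'.hasDerivAt).differentiableAt
    refine h3.congr_of_eventuallyEq ?_
    filter_upwards [hc.eventually (hχ.eventually_left_inverse hne)] with s hs
    exact hs.symm

theorem e_chi (x : ℤˣ) {γ : ℝ → ℂ} {t : ℝ} (hc : ContinuousAt γ t)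
    (ht : γ t ∈ ({0, 1, -1} : Set ℂ)ᶜ) :
    e ((x : ℤ) : ℂ) (chi (γ t)) * deriv (fun t => chi (γ t)) t = h x x (γ t) * deriv γ t := by
  rw [deriv_chi_comp hc ht, ← mul_assoc]
  congr 1
  simp only [mem_compl_iff, mem_insert_iff, mem_singleton_iff, not_or] at ht
  obtain ⟨h0, h1, h2⟩ := ht
  generalize γ t = τ at *
  have h1' : τ - 1 ≠ 0 := sub_ne_zero.2 h1
  have h2' : τ + 1 ≠ 0 := fun h => h2 (eq_neg_of_add_eq_zero_left h)
  rcases Int.units_eq_one_or x with rfl | rfl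
  · have : chi τ - 1 = (τ - 1) ^ 2 / (2 * τ) := by unfold chi; field_simp; ring
    simp only [h, e, if_true, Units.val_one, Int.cast_one, this, sub_zero]
    field_simp
    ring
  · have : chi τ + 1 = (τ + 1) ^ 2 / (2 * τ) := by unfold chi; field_simp; ring
    simp only [h, e, if_true, Units.val_neg, Units.val_one, Int.cast_neg, Int.cast_one,
      sub_neg_eq_add, this, sub_zero]
    field_simp
    ring

/-! ### Words in the forms `e_0`, `e_1`, `e_{-1}` -/

theorem differentiableOn_e (w : ℂ) {W : Set ℂ} (hw : w ∉ W) : DifferentiableOn ℂ (e w) W :=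
  (differentiableOn_const 1).div (differentiableOn_id.sub_const w)
    fun _ hz => sub_ne_zero.2 fun h => hw (h ▸ hz)

theorem differentiableOn_h (x y : ℤˣ) : DifferentiableOn ℂ (h x y) ({0, 1, -1} : Set ℂ)ᶜ :=
  ((((differentiableOn_e 0 (by simp)).const_mul _).add
    ((differentiableOn_e 1 (by simp)).const_mul _)).add
    ((differentiableOn_e (-1) (by simp)).const_mul _)).congr fun z _ => h_eq x y z

theorem simplePoles_of_eq {ω : ℕ → ℂ → ℂ} {α β δ : ℕ → ℂ} {w₁ w₂ p : ℂ} (h₁ : 1 ≤ dist w₁ p)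
    (h₂ : 1 ≤ dist w₂ p) (hω : ∀ k z, ω k z = α k * e w₁ z + β k * e p z + δ k * e w₂ z) :
    SimplePoles ω p β fun k z => α k * e w₁ z + δ k * e w₂ z := by
  refine fun k => ⟨((differentiableOn_e w₁ fun h => ?_).const_mul _).add
    ((differentiableOn_e w₂ fun h => ?_).const_mul _), fun z _ _ => ?_⟩
  · exact absurd (Metric.mem_ball.1 h) (not_lt.2 h₁)
  · exact absurd (Metric.mem_ball.1 h) (not_lt.2 h₂)
  · rw [hω]
    simp only [e]
    ring

/-- Only `h 1 1` has a pole at `1` and only `h (-1) (-1)` has one at `-1`, so the two hypotheses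
express regularity of the first and last letters at the endpoints. -/
theorem exists_tendsto_iter_h (n : ℕ) (x y : ℕ → ℤˣ) (h0 : x 0 ≠ 1 ∨ y 0 ≠ 1)
    (hn : x (n - 1) ≠ -1 ∨ y (n - 1) ≠ -1) :
    ∃ L, ∀ γ, IsHalfTurn γ →
      Tendsto (fun p : ℝ × ℝ => iter (letters γ fun k => h (x k) (y k)) n p.1 p.2)
        (𝓝[>] (0 : ℝ) ×ˢ 𝓝[<] (1 : ℝ)) (𝓝 L) := by
  refine exists_tendsto_iter n (fun k => differentiableOn_h (x k) (y k))
    (simplePoles_of_eq (w₁ := 0) (w₂ := -1) (by simp) (by norm_num [Complex.dist_eq])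
      fun k z => h_eq (x k) (y k) z)
    (simplePoles_of_eq (w₁ := 0) (w₂ := 1)
      (α := fun k => -if x (n - 1 - k) = y (n - 1 - k) then -1 else 1)
      (β := fun k => -if x (n - 1 - k) = -1 ∧ y (n - 1 - k) = -1 then 2 else 0)
      (δ := fun k => -if x (n - 1 - k) = 1 ∧ y (n - 1 - k) = 1 then 2 else 0)
      (by simp) (by norm_num [Complex.dist_eq]) fun k z => ?_) ?_ ?_
  · rw [h_eq]
    ring
  · exact if_neg fun h => h0.elim (fun g => g h.1) fun g => g h.2
  · simp only [Nat.sub_zero, neg_eq_zero]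
    exact if_neg fun h => hn.elim (fun g => g h.1) fun g => g h.2

theorem truncated_eq_iter {n : ℕ} {γ : ℝ → ℂ} {ω : Fin n → ℂ → ℂ} {φ : ℕ → ℝ → ℂ} (hφ : LocInt φ)
    {a b : ℝ} (ha : a ∈ Ioo (0 : ℝ) 1) (hb : b ∈ Ioo (0 : ℝ) 1) (hab : a ≤ b)
    (h : ∀ i : Fin n, ∀ t ∈ Ioo (0 : ℝ) 1, ω i (γ t) * deriv γ t = φ i t) :
    truncated γ ω a b = iter φ n a b := by
  rw [truncated, ← integral_simplex hab
    fun k => ((hφ k a ha b hb).1).mono_set Ioo_subset_Ioc_self]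
  refine setIntegral_congr_fun (measurableSet_simplex n a b) fun t ht => ?_
  exact Finset.prod_congr rfl fun i _ =>
    h i (t i) ⟨ha.1.trans (ht.2 i).1, (ht.2 i).2.trans hb.2⟩

theorem eventually_times : ∀ᶠ p : ℝ × ℝ in 𝓝[>] (0 : ℝ) ×ˢ 𝓝[<] (1 : ℝ),
    p.1 ∈ Ioo (0 : ℝ) 1 ∧ p.2 ∈ Ioo (0 : ℝ) 1 ∧ p.1 ≤ p.2 := by
  have h1 : ∀ᶠ a in 𝓝[>] (0 : ℝ), a ∈ Ioo (0 : ℝ) (1 / 2) := Ioo_mem_nhdsGT (by norm_num)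
  have h2 : ∀ᶠ b in 𝓝[<] (1 : ℝ), b ∈ Ioo (1 / 2 : ℝ) 1 := Ioo_mem_nhdsLT (by norm_num)
  filter_upwards [h1.prod_mk h2] with p hp
  exact ⟨⟨hp.1.1, hp.1.2.trans (by norm_num)⟩, ⟨lt_trans (by norm_num) hp.2.1, hp.2.2⟩,
    hp.1.2.le.trans hp.2.1.le⟩

theorem hasIteratedIntegral_of_tendsto_iter {n : ℕ} {γ : ℝ → ℂ} {ω : Fin n → ℂ → ℂ}
    {φ : ℕ → ℝ → ℂ} (hφ : LocInt φ)
    (h : ∀ i : Fin n, ∀ t ∈ Ioo (0 : ℝ) 1, ω i (γ t) * deriv γ t = φ i t) {L : ℂ}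
    (hL : Tendsto (fun p : ℝ × ℝ => iter φ n p.1 p.2) (𝓝[>] (0 : ℝ) ×ˢ 𝓝[<] (1 : ℝ)) (𝓝 L)) :
    HasIteratedIntegral γ ω L := by
  refine hL.congr' ?_
  filter_upwards [eventually_times] with p hp
  exact (truncated_eq_iter hφ hp.1 hp.2.1 hp.2.2 h).symm

theorem iter_congr {φ φ' : ℕ → ℝ → ℂ} (h : ∀ k, ∀ t ∈ Ioo (0 : ℝ) 1, φ k t = φ' k t) (m : ℕ) {a b : ℝ}
    (ha : a ∈ Ioo (0 : ℝ) 1) (hb : b ∈ Ioo (0 : ℝ) 1) : iter φ m a b = iter φ' m a b := by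
  induction m generalizing b with
  | zero => rfl
  | succ m ih =>
    refine intervalIntegral.integral_congr fun t ht => ?_
    have ht' := uIcc_subset_Ioo ha hb ht
    simp only [ih ht', h m t ht']

/-! ### Complete integrals of the densities -/

/-- The word of densities given by the pairs of letters `x k`, `y k`. -/
noncomputable def densities (x y : ℕ → ℤˣ) : ℕ → ℝ → ℂ := fun k => density (x k) (y k)

theorem locInt_densities (x y : ℕ → ℤˣ) : LocInt (densities x y) := fun k _ ha _ hb =>
  ((continuousOn_density (x k) (y k)).mono (uIcc_subset_Ioo ha hb)).intervalIntegrable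

theorem iter_halfCircle (x y : ℕ → ℤˣ) (m : ℕ) {a b : ℝ} (ha : a ∈ Ioo (0 : ℝ) 1)
    (hb : b ∈ Ioo (0 : ℝ) 1) :
    iter (letters halfCircle fun k => h (x k) (y k)) m a b =
      iter (densities x y) m (coord a) (coord b) := by
  rw [iter_congr (φ := letters halfCircle fun k => h (x k) (y k))
    (fun k t ht => h_halfCircle (x k) (y k) ht) m ha hb]
  refine iter_substitution (fun k => continuousOn_density (x k) (y k)) (fun t ht => coord_mem ht)
    (fun t _ => hasDerivAt_coord t) ?_ m ha hb
  unfold coordDeriv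
  fun_prop

theorem iter_densities (x y : ℕ → ℤˣ) (m : ℕ) {a b : ℝ} (ha : a ∈ Ioo (0 : ℝ) 1)
    (hb : b ∈ Ioo (0 : ℝ) 1) (hab : a ≤ b) :
    iter (densities x y) m a b = (∏ i : Fin m, phase (x i) * phase (y i)) *
      ((∫ t in simplex m a b, ∏ i : Fin m, weight (x i) (t i) * weight (y i) (t i) : ℝ) : ℂ) := by
  rw [← integral_simplex hab
    fun k => ((locInt_densities x y k a ha b hb).1).mono_set Ioo_subset_Ioc_self,
    ← integral_complex_ofReal, ← integral_const_mul]
  refine integral_congr_ae (Eventually.of_forall fun t => ?_)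
  simp only [densities, density, Finset.prod_mul_distrib, Complex.ofReal_prod, Complex.ofReal_mul]

theorem aecover_simplex {ι : Type*} {l : Filter ι} (n : ℕ) {u w : ι → ℝ} (hu : Tendsto u l (𝓝 0))
    (hw : Tendsto w l (𝓝 1)) :
    AECover (volume.restrict (simplex n 0 1)) l fun i => simplex n (u i) (w i) := by
  refine ⟨(ae_restrict_iff' (measurableSet_simplex n 0 1)).2 (Eventually.of_forall fun t ht => ?_),
    fun i => measurableSet_simplex n _ _⟩
  have : ∀ᶠ i in l, ∀ j, t j ∈ Ioo (u i) (w i) := eventually_all.2 fun j =>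
    (hu.eventually_lt_const (ht.2 j).1).and (hw.eventually_const_lt (ht.2 j).2)
  filter_upwards [this] with i hi using ⟨ht.1, hi⟩

theorem prod_weight_nonneg (x y : ℕ → ℤˣ) (m : ℕ) (t : Fin m → ℝ) :
    0 ≤ ∏ i : Fin m, weight (x i) (t i) * weight (y i) (t i) :=
  Finset.prod_nonneg fun _ _ => mul_nonneg (weight_nonneg _ _) (weight_nonneg _ _)

theorem measurable_weight (x : ℤˣ) : Measurable (weight x) := (measurable_q x).sqrt.inv

theorem measurable_prod_weight (x y : ℕ → ℤˣ) (m : ℕ) :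
    Measurable fun t : Fin m → ℝ => ∏ i : Fin m, weight (x i) (t i) * weight (y i) (t i) :=
  Finset.measurable_fun_prod _ fun i _ =>
    ((measurable_weight _).comp (measurable_pi_apply i)).mul
      ((measurable_weight _).comp (measurable_pi_apply i))

theorem lintegral_prod_weight (x y : ℕ → ℤˣ) (m : ℕ) :
    ∫⁻ t in simplex m 0 1, ENNReal.ofReal (∏ i : Fin m, weight (x i) (t i) * weight (y i) (t i)) =
      liter (fun i v => k (x i) v * k (y i) v) m 0 1 := by
  rw [← lintegral_simplex fun i => (measurable_k (x i)).fun_mul (measurable_k (y i))]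
  refine lintegral_congr fun t => ?_
  rw [ENNReal.ofReal_prod_of_nonneg
    fun _ _ => mul_nonneg (weight_nonneg _ _) (weight_nonneg _ _)]
  refine Finset.prod_congr rfl fun i _ => ?_
  rw [ENNReal.ofReal_mul (weight_nonneg _ _)]
  rfl

theorem phase_ne_zero (x : ℤˣ) : phase x ≠ 0 := by
  unfold phase
  split_ifs <;> simp

/-- A conditionally convergent iterated integral of densities converges absolutely. -/
theorem integrableOn_of_tendsto (x y : ℕ → ℤˣ) (m : ℕ) {J : ℂ}
    (hJ : Tendsto (fun p : ℝ × ℝ => iter (densities x y) m (coord p.1) (coord p.2))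
      (𝓝[>] (0 : ℝ) ×ˢ 𝓝[<] (1 : ℝ)) (𝓝 J)) :
    IntegrableOn (fun t => ∏ i : Fin m, weight (x i) (t i) * weight (y i) (t i)) (simplex m 0 1) ∧
      J = (∏ i : Fin m, phase (x i) * phase (y i)) *
        ((∫ t in simplex m 0 1, ∏ i : Fin m, weight (x i) (t i) * weight (y i) (t i) : ℝ) : ℂ) := by
  set Ψ : ℂ := ∏ i : Fin m, phase (x i) * phase (y i) with hΨ
  have hΨ0 : Ψ ≠ 0 := Finset.prod_ne_zero_iff.2 fun i _ =>
    mul_ne_zero (phase_ne_zero _) (phase_ne_zero _)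
  let f : (Fin m → ℝ) → ℝ := fun t => ∏ i : Fin m, weight (x i) (t i) * weight (y i) (t i)
  -- One sequence of symmetric cuts suffices, since the integrand is nonnegative; the factor `1 / 2`
  -- gives `a j ≤ 1 - a j`.
  let a : ℕ → ℝ := fun j => 1 / 2 * (1 / (j + 1))
  have ha : ∀ j, a j ∈ Ioc (0 : ℝ) (1 / 2) := by
    intro j
    have : (1 : ℝ) / (j + 1) ≤ 1 := by
      rw [div_le_one (by positivity)]; linarith [(Nat.cast_nonneg j : (0 : ℝ) ≤ j)]
    exact ⟨by positivity, by simp only [a]; linarith⟩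
  have ha1 : ∀ j, a j ∈ Ioo (0 : ℝ) 1 := fun j => ⟨(ha j).1, (ha j).2.trans_lt (by norm_num)⟩
  have ha2 : ∀ j, 1 - a j ∈ Ioo (0 : ℝ) 1 := fun j => one_sub_mem_Ioo (ha1 j)
  have hat : Tendsto a atTop (𝓝 0) := by
    have := (tendsto_one_div_add_atTop_nhds_zero_nat (𝕜 := ℝ)).const_mul (1 / 2)
    simpa [a] using this
  have hat1 : Tendsto a atTop (𝓝[>] 0) :=
    tendsto_nhdsWithin_iff.2 ⟨hat, Eventually.of_forall fun j => (ha j).1⟩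
  have hat2 : Tendsto (fun j => 1 - a j) atTop (𝓝[<] 1) :=
    tendsto_nhdsWithin_iff.2 ⟨by simpa using hat.const_sub 1,
      Eventually.of_forall fun j => (ha2 j).2⟩
  have hle : ∀ j, coord (a j) ≤ coord (1 - a j) := by
    intro j
    have h1 := half_angle_mem (ha1 j)
    have h2 := half_angle_mem (ha2 j)
    refine pow_le_pow_left₀ (sin_cos_half_pos (ha1 j)).1.le ?_ 2
    refine Real.sin_le_sin_of_le_of_le_pi_div_two (by linarith [h1.1, Real.pi_pos]) h2.2.le ?_
    have : a j ≤ 1 - a j := by linarith [(ha j).2]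
    have := mul_le_mul_of_nonneg_left this Real.pi_pos.le
    linarith
  have hseq : Tendsto (fun j => ((∫ t in simplex m (coord (a j)) (coord (1 - a j)), f t : ℝ) : ℂ))
      atTop (𝓝 (Ψ⁻¹ * J)) := by
    refine ((hJ.comp (hat1.prodMk hat2)).const_mul Ψ⁻¹).congr fun j => ?_
    simp only [Function.comp]
    rw [iter_densities x y m (coord_mem (ha1 j)) (coord_mem (ha2 j)) (hle j), ← mul_assoc,
      inv_mul_cancel₀ hΨ0, one_mul]
  have hre := (Complex.continuous_re.tendsto _).comp hseq
  simp only [Function.comp_def, Complex.ofReal_re] at hre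
  have hcov : AECover (volume.restrict (simplex m 0 1)) atTop
      fun j => simplex m (coord (a j)) (coord (1 - a j)) :=
    aecover_simplex m ((tendsto_nhdsWithin_iff.1 (tendsto_coord_zero.comp hat1)).1)
      ((tendsto_nhdsWithin_iff.1 (tendsto_coord_one.comp hat2)).1)
  have hsub : ∀ j, simplex m (coord (a j)) (coord (1 - a j)) ⊆ simplex m 0 1 := fun j =>
    simplex_mono (coord_mem (ha1 j)).1.le (coord_mem (ha2 j)).2.le
  have hint : ∀ j, IntegrableOn f (simplex m (coord (a j)) (coord (1 - a j)))
      (volume.restrict (simplex m 0 1)) := by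
    intro j
    have hw : ∀ z, IntegrableOn (fun v => weight (x z) v * weight (y z) v)
        (Ioo (coord (a j)) (coord (1 - a j))) := by
      intro z
      have hc := ((continuousOn_weight (x z)).mul (continuousOn_weight (y z))).mono
        (uIcc_subset_Ioo (coord_mem (ha1 j)) (coord_mem (ha2 j)))
      exact (hc.intervalIntegrable (μ := volume)).1.mono_set Ioo_subset_Ioc_self
    have := integrableOn_simplex (n := m) (fun i => hw i)
    rw [IntegrableOn, Measure.restrict_restrict (measurableSet_simplex _ _ _),
      inter_eq_left.2 (hsub j)]
    exact this
  have hre' : Tendsto (fun j => ∫ t in simplex m (coord (a j)) (coord (1 - a j)), f t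
      ∂(volume.restrict (simplex m 0 1))) atTop (𝓝 (Ψ⁻¹ * J).re) := by
    refine hre.congr fun j => ?_
    rw [Measure.restrict_restrict (measurableSet_simplex _ _ _), inter_eq_left.2 (hsub j)]
  have hnn : 0 ≤ᵐ[volume.restrict (simplex m 0 1)] f :=
    Eventually.of_forall fun t => prod_weight_nonneg x y m t
  refine ⟨hcov.integrable_of_integral_tendsto_of_nonneg_ae _ hint hnn hre', ?_⟩
  have hval := hcov.integral_eq_of_tendsto_of_nonneg_ae _ hnn hint hre'
  have h1 := tendsto_nhds_unique hseq ((Complex.continuous_ofReal.tendsto _).comp hre)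
  rw [show (∫ t in simplex m 0 1, ∏ i : Fin m, weight (x i) (t i) * weight (y i) (t i)) =
    (Ψ⁻¹ * J).re from hval, ← h1, ← mul_assoc, mul_inv_cancel₀ hΨ0, one_mul]

/-- An absolutely convergent iterated integral of densities converges. -/
theorem tendsto_iter_densities (x y : ℕ → ℤˣ) (m : ℕ)
    (hi : IntegrableOn (fun t => ∏ i : Fin m, weight (x i) (t i) * weight (y i) (t i))
      (simplex m 0 1)) :
    Tendsto (fun p : ℝ × ℝ => iter (densities x y) m p.1 p.2) (𝓝[>] (0 : ℝ) ×ˢ 𝓝[<] (1 : ℝ))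
      (𝓝 ((∏ i : Fin m, phase (x i) * phase (y i)) *
        ((∫ t in simplex m 0 1, ∏ i : Fin m, weight (x i) (t i) * weight (y i) (t i) : ℝ) : ℂ))) := by
  have hcov : AECover (volume.restrict (simplex m 0 1)) (𝓝[>] (0 : ℝ) ×ˢ 𝓝[<] (1 : ℝ))
      fun p : ℝ × ℝ => simplex m p.1 p.2 :=
    aecover_simplex m (tendsto_fst.mono_right nhdsWithin_le_nhds)
      (tendsto_snd.mono_right nhdsWithin_le_nhds)
  have h1 := (((Complex.continuous_ofReal.tendsto _).comp
    (hcov.integral_tendsto_of_countably_generated hi)).const_mul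
    (∏ i : Fin m, phase (x i) * phase (y i)))
  refine h1.congr' ?_
  filter_upwards [eventually_times] with p hp
  rw [iter_densities x y m hp.1 hp.2.1 hp.2.2]
  simp only [Function.comp]
  rw [Measure.restrict_restrict (measurableSet_simplex _ _ _),
    inter_eq_left.2 (simplex_mono hp.1.1.le hp.2.1.2.le)]

/-- Comparison of the complete integrals. -/
theorem integral_prod_weight (x : ℕ → ℤˣ) (hx : x 0 = 1) (n : ℕ) (hn : x n = 1)
    (hn1 : x (n + 1) = -1)
    (hi : IntegrableOn (fun t => ∏ i : Fin (n + 1), weight (x i) (t i) * weight (x (i + 1)) (t i))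
      (simplex (n + 1) 0 1)) :
    IntegrableOn (fun t => ∏ i : Fin n, weight (x (i + 1)) (t i) * weight (x (i + 1)) (t i))
        (simplex n 0 1) ∧
      ∫ t in simplex (n + 1) 0 1, ∏ i : Fin (n + 1), weight (x i) (t i) * weight (x (i + 1)) (t i) =
        Real.pi * ∫ t in simplex n 0 1,
          ∏ i : Fin n, weight (x (i + 1)) (t i) * weight (x (i + 1)) (t i) := by
  have h1 := lintegral_prod_weight x (fun i => x (i + 1)) (n + 1)
  have h2 := lintegral_prod_weight (fun i => x (i + 1)) (fun i => x (i + 1)) n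
  have hmain := liter_zero_one x hx n hn hn1
  rw [← h1, ← h2] at hmain
  have hfin := hi.lintegral_lt_top
  rw [hmain] at hfin
  have hfin' : ∫⁻ t in simplex n 0 1, ENNReal.ofReal
      (∏ i : Fin n, weight (x (i + 1)) (t i) * weight (x (i + 1)) (t i)) ≠ ⊤ := by
    -- Here `π > 0` matters: finiteness of `π` times the right integral gives finiteness of that
    -- integral itself.
    intro htop
    rw [htop, ENNReal.mul_top (by simpa using Real.pi_pos)] at hfin
    exact lt_irrefl _ hfin
  have hm := (measurable_prod_weight (fun i => x (i + 1)) (fun i => x (i + 1)) n)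
  refine ⟨(lintegral_ofReal_ne_top_iff_integrable hm.aestronglyMeasurable
    (Eventually.of_forall fun t =>
      prod_weight_nonneg (fun i => x (i + 1)) (fun i => x (i + 1)) n t)).1 hfin', ?_⟩
  rw [integral_eq_lintegral_of_nonneg_ae (Eventually.of_forall fun t =>
      prod_weight_nonneg x (fun i => x (i + 1)) (n + 1) t)
      (measurable_prod_weight x (fun i => x (i + 1)) (n + 1)).aestronglyMeasurable,
    integral_eq_lintegral_of_nonneg_ae (Eventually.of_forall fun t =>
      prod_weight_nonneg (fun i => x (i + 1)) (fun i => x (i + 1)) n t) hm.aestronglyMeasurable,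
    hmain, ENNReal.toReal_mul, ENNReal.toReal_ofReal Real.pi_pos.le]

/-- Each inner sign occurs in two adjacent letters, so only the phases of the outer signs stay
unpaired. The first is `1`; for last sign `-1` the other is the factor `i` of the theorem. -/
theorem prod_phase (x : ℕ → ℤˣ) (hx : x 0 = 1) (n : ℕ) :
    ∏ i : Fin (n + 1), phase (x i) * phase (x (i + 1)) =
      phase (x (n + 1)) * ∏ i : Fin n, phase (x (i + 1)) * phase (x (i + 1)) := by
  induction n with
  | zero => simp [hx, phase]
  | succ n ih =>
    rw [Fin.prod_univ_castSucc]
    simp only [Fin.val_castSucc, Fin.val_last]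
    rw [ih, Fin.prod_univ_castSucc (n := n)]
    simp only [Fin.val_castSucc, Fin.val_last]
    ring

end IterInt

/-! ### Assembly of the theorem -/

open IterInt in
theorem mainTheorem2 (n : ℕ) (x : Fin (n + 2) → ℤˣ)
    (hx_first : x 0 = 1) (hx_source : x 0 ≠ x 1)
    (hx_target : x (Fin.last n).castSucc ≠ x (Fin.last (n + 1)))
    (hx_last : x (Fin.last (n + 1)) = -1)
    (γ : ℝ → ℂ) (hγ : IterInt.IsHalfTurn γ) :
    ∃ L J : ℂ,
      IterInt.HasIteratedIntegral IterInt.dch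
        (fun i : Fin n => IterInt.e ((x i.succ.castSucc : ℤ) : ℂ)) L ∧
      IterInt.HasIteratedIntegral (fun t => IterInt.chi (γ t))
        (fun i : Fin n => IterInt.e ((x i.succ.castSucc : ℤ) : ℂ)) L ∧
      IterInt.HasIteratedIntegral γ
        (fun i : Fin (n + 1) => IterInt.h (x i.castSucc) (x i.succ)) J ∧
      L = ((Real.pi : ℂ) * Complex.I)⁻¹ * J := by
  -- Words are infinite sequences of which an initial segment is integrated; the default sign `1` is
  -- never read in the result.
  let X : ℕ → ℤˣ := fun k => if hk : k < n + 2 then x ⟨k, hk⟩ else 1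
  have hX : ∀ k (hk : k < n + 2), X k = x ⟨k, hk⟩ := fun k hk => dif_pos hk
  have hX0 : X 0 = 1 := (hX 0 (by omega)).trans hx_first
  have hX1 : X 1 ≠ 1 := by
    rw [hX 1 (by omega), ← hx_first]
    exact hx_source.symm
  have hXl : X (n + 1) = -1 := (hX (n + 1) (by omega)).trans hx_last
  have hXn : X n = 1 := by
    rcases Int.units_eq_one_or (X n) with h1 | h1
    · exact h1
    · exfalso
      rw [hx_last] at hx_target
      exact hx_target ((hX n (by omega)).symm.trans h1)
  have hsucc : ∀ i : Fin n, X (i + 1) = x i.succ.castSucc := fun i => hX _ (by omega)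
  have hne : (1 : ℤˣ) ≠ -1 := by decide
  obtain ⟨J, hJ⟩ := exists_tendsto_iter_h (n + 1) X (fun k => X (k + 1)) (Or.inr hX1)
    (Or.inl (by simp [hXn]))
  obtain ⟨L', hL'⟩ : ∃ L, ∀ γ, IsHalfTurn γ →
      Tendsto (fun p : ℝ × ℝ => iter (letters γ fun k => h (X (k + 1)) (X (k + 1))) n p.1 p.2)
        (𝓝[>] (0 : ℝ) ×ˢ 𝓝[<] (1 : ℝ)) (𝓝 L) := by
    -- For `n = 0` the empty word has no last letter: `n - 1 + 1` would be `1`, and `X 1 = -1`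
    -- violates the regularity condition.
    rcases Nat.eq_zero_or_pos n with rfl | hn
    · exact ⟨1, fun γ _ => tendsto_const_nhds⟩
    · refine exists_tendsto_iter_h n (fun k => X (k + 1)) (fun k => X (k + 1)) (Or.inl hX1)
        (Or.inl ?_)
      simp only [Nat.sub_add_cancel hn, hXn]
      exact hne
  have hcoord : Tendsto (fun p : ℝ × ℝ => (coord p.1, coord p.2))
      (𝓝[>] (0 : ℝ) ×ˢ 𝓝[<] (1 : ℝ)) (𝓝[>] (0 : ℝ) ×ˢ 𝓝[<] (1 : ℝ)) :=
    tendsto_coord_zero.prodMap tendsto_coord_one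
  have hJ' : Tendsto (fun p : ℝ × ℝ =>
      iter (densities X fun k => X (k + 1)) (n + 1) (coord p.1) (coord p.2))
      (𝓝[>] (0 : ℝ) ×ˢ 𝓝[<] (1 : ℝ)) (𝓝 J) := by
    refine (hJ _ isHalfTurn_halfCircle).congr' ?_
    filter_upwards [eventually_times] with p hp using iter_halfCircle _ _ _ hp.1 hp.2.1
  obtain ⟨hi, hJval⟩ := integrableOn_of_tendsto _ _ _ hJ'
  obtain ⟨hi', hval⟩ := integral_prod_weight X hX0 n hXn hXl hi
  have hL := tendsto_iter_densities (fun k => X (k + 1)) (fun k => X (k + 1)) n hi'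
  -- The substitution by `coord` identifies the straight-path value with the common value of the
  -- words in `h x x` along half-turns, hence along `χ ∘ γ`.
  have hLL' := tendsto_nhds_unique ((hL.comp hcoord).congr' (by
    filter_upwards [eventually_times] with p hp using
      (iter_halfCircle (fun k => X (k + 1)) (fun k => X (k + 1)) n hp.1 hp.2.1).symm))
    (hL' _ isHalfTurn_halfCircle)
  have hreg := hγ.piecewise.regularPath
  refine ⟨_, J, hasIteratedIntegral_of_tendsto_iter (locInt_densities _ _) (fun i t ht => ?_) hL,
    hasIteratedIntegral_of_tendsto_iter (hreg.locInt hγ.maps fun k => (differentiableOn_h _ _).continuousOn) (fun i t ht => ?_)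
      (hLL' ▸ hL' γ hγ),
    hasIteratedIntegral_of_tendsto_iter (hreg.locInt hγ.maps fun k => (differentiableOn_h _ _).continuousOn) (fun i t ht => ?_)
      (hJ γ hγ), ?_⟩
  · rw [← hsucc]
    exact e_dch _ ht
  · rw [← hsucc]
    exact e_chi _ (hreg.cont.continuousAt (isOpen_Ioo.mem_nhds ht)) (hγ.mem t ht)
  · have h1 : X i = x i.castSucc := hX i i.castSucc.2
    have h2 : X (i + 1) = x i.succ := hX (i + 1) i.succ.2
    rw [← h1, ← h2]
    rfl
  · rw [hJval, hval, prod_phase X hX0, hXl]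
    have hpi : (Real.pi : ℂ) ≠ 0 := by exact_mod_cast Real.pi_ne_zero
    simp only [phase, hne.symm, if_false]
    push_cast
    field_simp
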